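/- A ($\mathbb{Z}$-)subshift is a compact set $X\subset\mathbb{N}^{\mathbb{Z}}$ (product of discrete topologies; so $X\subset S^{\mathbb{Z}}$ for some finite $S$) with $\sigma(X)=X$, where $\sigma(x)_i=x_{i+1}$. Its language $\mathcal{B}(X)$ is the set of finite words occurring in points of $X$. A subshift $X$ is recursive if $\mathcal{B}(X)$ is a recursive set; minimal if it is nonempty and its only subshifts are $\emptyset$ and $X$; quasiminimal if it has only finitely many proper subshifts; transitive if some $x\in X$ contains every word of $\mathcal{B}(X)$ infinitely many times in both of its tails. The halting problem along a clopen set for $X$ is: given clopen sets $C,D,E$ (each as a position $i\in\mathbb{Z}$ together with a finite list of words, describing the union of the corresponding cylinders at position $i$), decide whether there are $x\in X$ and $j\in\mathbb{N}=\{0,1,2,\ldots\}$ with $x\in C$, $\sigma^j(x)\in D$ and $\sigma^i(x)\in E$ for all $1\le i\le j-1$. A subshift $X$ is universal if the problem of deciding, given a finite-state automaton accepting a regular language $L$, whether $\mathcal{B}(X)\cap L\neq\emptyset$, is $\Sigma^0_1$-complete. Here $\Sigma^0_1$-complete means recursively enumerable and complete under many-one reductions. Theorem. For every recursive infinite minimal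 subshift $Y$ there is a transitive, uncountable, recursive, quasiminimal subshift $X$ such that $Y$ is the only subshift $Z$ with $\emptyset\neq Z\subsetneq X$, and such that the halting problem along a clopen set for $X$ is $\Sigma^0_1$-complete. Moreover, there exists a recursive universal quasiminimal $\mathbb{Z}$-subshift; thus a recursive universal subshift need not have infinitely many subsystems. -/

import Mathlib

namespace ZShift

/-- The shift map on bi-infinite sequences, `σ(x)_i = x_{i+1}`. -/
def shift (x : ℤ → ℕ) : ℤ → ℕ := fun i => x (i + 1)

/-- The word `w` occurs in `x` at position `i`, that is, `x_{[i, i+|w|-1]} = w`. -/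
def OccursAt (w : List ℕ) (x : ℤ → ℕ) (i : ℤ) : Prop :=
  ∀ (k : ℕ) (hk : k < w.length), x (i + k) = w[k]

/-- A subshift: a compact shift-invariant subset of `ℕ^ℤ` (product of discrete topologies).
Compactness forces all its points to live over a common finite alphabet. -/
def IsSubshift (X : Set (ℤ → ℕ)) : Prop :=
  IsCompact X ∧ shift '' X = X

/-- The language of `X`: the set of all finite words occurring in points of `X`. -/
def language (X : Set (ℤ → ℕ)) : Set (List ℕ) :=
  {w | ∃ x ∈ X, ∃ i : ℤ, OccursAt w x i}

/-- `X` is recursive if its language is a recursive set of words. -/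
def IsRecursive (X : Set (ℤ → ℕ)) : Prop :=
  ComputablePred fun w : List ℕ => w ∈ language X

/-- `X` is a minimal subshift: nonempty, with no subshifts other than `∅` and `X`. -/
def IsMinimalSubshift (X : Set (ℤ → ℕ)) : Prop :=
  IsSubshift X ∧ X.Nonempty ∧ ∀ Z : Set (ℤ → ℕ), IsSubshift Z → Z ⊆ X → Z = ∅ ∨ Z = X

/-- `X` is a quasiminimal subshift: it has only finitely many proper subshifts. -/
def IsQuasiminimal (X : Set (ℤ → ℕ)) : Prop :=
  IsSubshift X ∧ {Z : Set (ℤ → ℕ) | IsSubshift Z ∧ Z ⊂ X}.Finite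

/-- `X` is transitive: some point of `X` is doubly transitive, that is, every word of the language
of `X` occurs infinitely many times in both of its tails. -/
def IsTransitive (X : Set (ℤ → ℕ)) : Prop :=
  ∃ x ∈ X, ∀ w ∈ language X, ∀ N : ℤ,
    (∃ i : ℤ, N ≤ i ∧ OccursAt w x i) ∧ (∃ i : ℤ, i ≤ N ∧ OccursAt w x i)

/-- `p` is `Σ⁰₁`-complete under many-one reductions. -/
def IsSigma1Complete {α : Type} [Primcodable α] (p : α → Prop) : Prop :=
  REPred p ∧ ∀ q : ℕ → Prop, REPred q → ManyOneReducible q p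

/-- A finite description of a clopen set: a position `i` and a finite list `C` of words. -/
abbrev ClopenCode : Type := ℤ × List (List ℕ)

/-- The clopen set `[C]_i`, the union of the cylinders `[w]_i` over `w` in `C`. Every clopen subset
of a subshift is the trace of a set of this form. -/
def ClopenCode.toSet (c : ClopenCode) : Set (ℤ → ℕ) :=
  {x | ∃ w ∈ c.2, OccursAt w x c.1}

/-- The halting problem along a clopen set: given `C`, `D`, `E`, decide whether some `x ∈ X` and
`j ∈ ℕ` satisfy `x ∈ C`, `σ^j(x) ∈ D` and `σ^i(x) ∈ E` for all `1 ≤ i ≤ j - 1`. -/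
def HaltingAlongClopen (X : Set (ℤ → ℕ)) : ClopenCode × ClopenCode × ClopenCode → Prop :=
  fun c => ∃ x ∈ X, ∃ j : ℕ, x ∈ c.1.toSet ∧ shift^[j] x ∈ c.2.1.toSet ∧
    ∀ i : ℕ, 1 ≤ i → i < j → shift^[i] x ∈ c.2.2.toSet

/-- A finite description of a finite-state automaton with states and letters in `ℕ`: the list of
transitions `(source, letter, target)`, the list of initial states, the list of final states. -/
abbrev AutomatonCode : Type := List (ℕ × ℕ × ℕ) × List ℕ × List ℕ

/-- The nondeterministic automaton described by a code. Only the finitely many states mentioned in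
the code matter, so the accepted languages are exactly the regular languages over finite
alphabets contained in `ℕ`. -/
def AutomatonCode.toNFA (M : AutomatonCode) : NFA ℕ ℕ where
  step q a := {q' | (q, a, q') ∈ M.1}
  start := {q | q ∈ M.2.1}
  accept := {q | q ∈ M.2.2}

/-- The model-checking problem for finite-state automata: given an automaton accepting `L`, decide
whether some word of the language of `X` belongs to `L`. -/
def ModelChecking (X : Set (ℤ → ℕ)) : AutomatonCode → Prop :=
  fun M => ∃ w ∈ language X, w ∈ M.toNFA.accepts

/-- `X` is universal: its model-checking problem for finite-state automata is
`Σ⁰₁`-complete. -/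
def IsUniversal (X : Set (ℤ → ℕ)) : Prop :=
  IsSigma1Complete (ModelChecking X)

end ZShift

open Filter Topology

/-! ### Words, languages and compactness -/

namespace ZShift

/-! Let `Y` be minimal and recursive over letters below `N`. One computes words `p 0, p 1, …` of
`Y`, each a prefix and a suffix of the next. With six extra letters, the markers `N, …, N + 5`, one
builds words `W_s` (`level`): `W_{s+1}` begins and ends with `W_s` and, if `s` codes the pair `(a,
t)`, contains the signal `(N+1) p_a (N+2) W_a (N+3) p_s μ`, where `μ` is `N+4` if the computation
numbered `a` halts within `t` steps and `N+5` otherwise. `X` consists of the points all of whose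
words occur in some `W_s`.

Quasiminimality. For each `k`, every marker of every `W_t` with `t ≥ k` lies within a bounded
distance of a copy of `W_k` (`near_level`), so a point of `X` with one marker contains every word of
the language. A point without markers lies in `Y` (`infix_level_of_lt`). Hence `Y` is the only
nonempty proper subshift. The copy of `W_a` inside the signal is there for this reason: a marker
between two long words `p_a` and `p_s` would be isolated.

Recursiveness. A word of length `l` sees only the ends of long blocks, and the possible junctions
between blocks all occur by stage `Nat.pair l l` (`infix_level_bound`). The tail `separated` shows
both `p_s (N+4) W_s` and `p_s (N+5) W_s` whatever the truth value, so late halting events leave no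
trace in short words.

Completeness. The computation `n` halts exactly when the language contains `(N+1) p_n (N+2) W_n
(N+3) v (N+4)` for some marker-free `v` (`exists_signal_mem_language`). The unknown gap `v` is
skipped by a loop of an automaton, or by a clopen set allowing only letters below `N`. Membership in
`Σ⁰₁` is a search over finite witnesses. If `Y` is infinite it is uncountable by Baire's theorem,
hence so is `X`; for the universal example `Y` may be a single fixed point. -/

/-- The word of length `n` read in `x` from position `i` on. -/
def word (x : ℤ → ℕ) (i : ℤ) (n : ℕ) : List ℕ := (List.range n).map fun k : ℕ => x (i + k)

@[simp] theorem length_word (x : ℤ → ℕ) (i : ℤ) (n : ℕ) : (word x i n).length = n := by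
  simp [word]

theorem getElem_word (x : ℤ → ℕ) (i : ℤ) (n k : ℕ) (h : k < (word x i n).length) :
    (word x i n)[k] = x (i + k) := by
  simp [word]

theorem occursAt_iff {w : List ℕ} {x : ℤ → ℕ} {i : ℤ} :
    OccursAt w x i ↔ word x i w.length = w := by
  constructor
  · intro h
    apply List.ext_getElem (by simp)
    intro k h1 h2
    rw [getElem_word, h k h2]
  · intro h k hk
    have h1 : k < (word x i w.length).length := by simpa using hk
    rw [← getElem_word x i w.length k h1]
    simp [h]

theorem mem_language {X : Set (ℤ → ℕ)} {w : List ℕ} :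
    w ∈ language X ↔ ∃ x ∈ X, ∃ i : ℤ, word x i w.length = w := by
  simp [language, occursAt_iff]

theorem word_mem_language {X : Set (ℤ → ℕ)} {x : ℤ → ℕ} (hx : x ∈ X) (i : ℤ) (n : ℕ) :
    word x i n ∈ language X :=
  mem_language.2 ⟨x, hx, i, by simp⟩

theorem word_add (x : ℤ → ℕ) (i : ℤ) (m n : ℕ) :
    word x i (m + n) = word x i m ++ word x (i + m) n := by
  simp [word, List.range_add, add_assoc]

theorem word_one (x : ℤ → ℕ) (i : ℤ) : word x i 1 = [x i] := by
  simp [word]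

theorem word_congr {x y : ℤ → ℕ} {i j : ℤ} {n : ℕ}
    (h : ∀ k : ℕ, k < n → x (i + k) = y (j + k)) : word x i n = word y j n := by
  apply List.map_congr_left
  intro k hk
  exact h k (by simpa using hk)

theorem word_translate (x : ℤ → ℕ) (c i : ℤ) (n : ℕ) :
    word (fun j => x (j + c)) i n = word x (i + c) n :=
  word_congr fun k _ => by ring_nf

/-- A factor of a word read in `x` is read in `x`. -/
theorem exists_word_of_infix {x : ℤ → ℕ} {i : ℤ} {n : ℕ} {u : List ℕ} (h : u <:+: word x i n) :
    ∃ k : ℕ, k + u.length ≤ n ∧ word x (i + k) u.length = u := by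
  obtain ⟨s, t, h⟩ := h
  have hn : n = s.length + (u.length + t.length) := by
    have := congrArg List.length h
    simp at this
    omega
  refine ⟨s.length, by omega, ?_⟩
  rw [hn, word_add, word_add, List.append_assoc] at h
  have h1 := (List.append_inj h (by simp)).2
  exact (List.append_inj h1 (by simp)).1.symm

theorem word_infix_word (x : ℤ → ℕ) {i j : ℤ} {m n : ℕ} (h1 : i ≤ j) (h2 : j + m ≤ i + n) :
    word x j m <:+: word x i n := by
  obtain ⟨k, rfl⟩ := Int.le.dest h1
  obtain ⟨l, rfl⟩ : ∃ l, n = k + (m + l) := ⟨n - k - m, by omega⟩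
  rw [word_add, word_add]
  exact ⟨_, _, List.append_assoc _ _ _⟩

theorem language_of_infix {X : Set (ℤ → ℕ)} {u w : List ℕ} (hw : w ∈ language X)
    (h : u <:+: w) : u ∈ language X := by
  obtain ⟨x, hx, i, hi⟩ := mem_language.1 hw
  rw [← hi] at h
  obtain ⟨k, -, hk⟩ := exists_word_of_infix h
  exact mem_language.2 ⟨x, hx, _, hk⟩

theorem language_mono {X Z : Set (ℤ → ℕ)} (h : X ⊆ Z) : language X ⊆ language Z := by
  rintro w ⟨x, hx, i, hi⟩
  exact ⟨x, h hx, i, hi⟩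

theorem shift_iterate (j : ℕ) (x : ℤ → ℕ) (i : ℤ) : shift^[j] x i = x (i + j) := by
  induction j generalizing x with
  | zero => simp
  | succ j ih =>
    rw [Function.iterate_succ_apply, ih]
    simp only [shift]
    push_cast
    ring_nf

theorem occursAt_shift_iterate {w : List ℕ} {x : ℤ → ℕ} {i : ℤ} {j : ℕ} :
    OccursAt w (shift^[j] x) i ↔ OccursAt w x (i + j) := by
  simp only [OccursAt, shift_iterate]
  refine forall₂_congr fun k _ => ?_
  rw [show i + (k : ℤ) + j = i + j + k by ring]

theorem occursAt_translate {w : List ℕ} {x : ℤ → ℕ} {i c : ℤ} :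
    OccursAt w (fun k => x (k + c)) i ↔ OccursAt w x (i + c) := by
  rw [occursAt_iff, occursAt_iff, word_translate]

theorem IsSubshift.translate_mem {X : Set (ℤ → ℕ)} (hX : IsSubshift X) {x : ℤ → ℕ} (hx : x ∈ X)
    (c : ℤ) : (fun i => x (i + c)) ∈ X := by
  have h1 : ∀ y ∈ X, (fun i => y (i + 1)) ∈ X := fun y hy => by
    rw [← hX.2]; exact ⟨y, hy, rfl⟩
  have h2 : ∀ y ∈ X, (fun i => y (i - 1)) ∈ X := fun y hy => by
    rw [← hX.2] at hy
    obtain ⟨z, hz, rfl⟩ := hy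
    simpa [shift] using hz
  induction c using Int.induction_on with
  | zero => simpa using hx
  | succ n ih =>
    have := h1 _ ih
    simpa [add_assoc, add_comm, add_left_comm] using this
  | pred n ih =>
    have := h2 _ ih
    convert this using 3
    ring

theorem isSubshift_of_translate {X : Set (ℤ → ℕ)} (h : IsCompact X)
    (h1 : ∀ x ∈ X, ∀ c : ℤ, (fun i => x (i + c)) ∈ X) : IsSubshift X := by
  refine ⟨h, Set.Subset.antisymm ?_ ?_⟩
  · rintro _ ⟨x, hx, rfl⟩
    exact h1 x hx 1
  · intro x hx
    refine ⟨_, h1 x hx (-1), ?_⟩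
    funext i
    simp [shift]

theorem continuous_translate (c : ℤ) : Continuous fun (x : ℤ → ℕ) (i : ℤ) => x (i + c) :=
  continuous_pi fun i => continuous_apply (i + c)

theorem isClopen_word_eq (i : ℤ) (n : ℕ) (S : Set (List ℕ)) :
    IsClopen {x : ℤ → ℕ | word x i n ∈ S} := by
  have : Continuous fun (x : ℤ → ℕ) (k : Fin n) => x (i + k) :=
    continuous_pi fun k => continuous_apply _
  have h2 : {x : ℤ → ℕ | word x i n ∈ S} =
      (fun (x : ℤ → ℕ) (k : Fin n) => x (i + k)) ⁻¹' {f | List.ofFn f ∈ S} := by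
    ext x
    simp only [Set.mem_ofPred_eq, Set.mem_preimage]
    rw [show word x i n = List.ofFn fun k : Fin n => x (i + k) from ?_]
    apply List.ext_getElem (by simp)
    intro k h1 h2
    simp [getElem_word]
  rw [h2]
  exact (isClopen_discrete _).preimage this

/-- A point all of whose words lie in the language of a subshift lies in the subshift. -/
theorem IsSubshift.mem_of_words {X : Set (ℤ → ℕ)} (hX : IsSubshift X) {x : ℤ → ℕ}
    (h : ∀ i n, word x i n ∈ language X) : x ∈ X := by
  rw [← hX.1.isClosed.closure_eq]
  -- A point of `X` agreeing with `x` on the window `[-n, n)`, obtained by translating an occurrence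
  -- of that central word.
  have h1 : ∀ n : ℕ, ∃ y ∈ X, ∀ i : ℤ, -n ≤ i → i < n → y i = x i := by
    intro n
    obtain ⟨y, hy, j, hj⟩ := mem_language.1 (h (-n) (2 * n))
    refine ⟨_, hX.translate_mem hy (j + n), fun i h1 h2 => ?_⟩
    obtain ⟨k, hk⟩ := Int.le.dest h1
    simp only [length_word] at hj
    have hl : k < (word y j (2 * n)).length := by simp; omega
    have hl' : k < (word x (-n) (2 * n)).length := by simpa using hl
    have e1 := getElem_word y j (2 * n) k hl
    have e2 := getElem_word x (-n) (2 * n) k hl'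
    rw [show i + (j + n) = j + k by omega, ← hk, ← e1, ← e2]
    simp [hj]
  choose y hy hxy using h1
  refine mem_closure_of_tendsto (f := y) (b := atTop) ?_ (Eventually.of_forall hy)
  rw [tendsto_pi_nhds]
  intro i
  apply tendsto_const_nhds.congr'
  filter_upwards [eventually_ge_atTop (i.natAbs + 1)] with n hn
  exact (hxy n i (by omega) (by omega)).symm

theorem IsSubshift.subset_of_language_subset {X Z : Set (ℤ → ℕ)} (hZ : IsSubshift Z)
    (h : language X ⊆ language Z) : X ⊆ Z := fun _ hx =>
  hZ.mem_of_words fun i n => h (word_mem_language hx i n)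

theorem IsSubshift.exists_bound {X : Set (ℤ → ℕ)} (hX : IsSubshift X) :
    ∃ N, ∀ x ∈ X, ∀ i, x i < N := by
  have h := (hX.1.image (continuous_apply (0 : ℤ))).finite_of_discrete.bddAbove
  obtain ⟨N, hN⟩ := h
  refine ⟨N + 1, fun x hx i => Nat.lt_succ_of_le ?_⟩
  exact hN ⟨_, hX.translate_mem hx i, by simp⟩

/-- The set of points all of whose words belong to `L`. -/
def pointsOf (L : Set (List ℕ)) : Set (ℤ → ℕ) := {x | ∀ i n, word x i n ∈ L}

theorem isSubshift_pointsOf {L : Set (List ℕ)} {N : ℕ} (hL : ∀ w ∈ L, ∀ a ∈ w, a < N) :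
    IsSubshift (pointsOf L) := by
  refine isSubshift_of_translate ?_ ?_
  · have hc : IsCompact (Set.univ.pi fun _ : ℤ => Set.Iio N) :=
      isCompact_univ_pi fun _ => (Set.finite_Iio N).isCompact
    refine hc.of_isClosed_subset ?_ ?_
    · have : pointsOf L = ⋂ (i : ℤ) (n : ℕ), {x | word x i n ∈ L} := by
        ext x; simp [pointsOf]
      rw [this]
      exact isClosed_iInter fun i => isClosed_iInter fun n => (isClopen_word_eq i n L).1
    · intro x hx i _
      exact hL _ (hx i 1) _ (by simp [word_one])
  · intro x hx c i n
    rw [word_translate]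
    exact hx _ _

/-! ### Minimal subshifts: uniform recurrence and uncountability -/

/-- Uniform recurrence. If arbitrarily long words avoided `u`, compactness would give a point of `Y`
avoiding `u`, and the points avoiding `u` would form a nonempty proper subshift. -/
theorem IsMinimalSubshift.exists_length_infix {Y : Set (ℤ → ℕ)} (hY : IsMinimalSubshift Y)
    {u : List ℕ} (hu : u ∈ language Y) :
    ∃ n : ℕ, ∀ v ∈ language Y, n ≤ v.length → u <:+: v := by
  obtain ⟨hs, hne, hmin⟩ := hY
  by_contra! hcon
  let Z : ℕ → Set (ℤ → ℕ) := fun n => {y ∈ Y | ¬ u <:+: word y (-n) (2 * n)}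
  have hZne : ∀ n, (Z n).Nonempty := by
    intro n
    obtain ⟨v, hv, hl, hv2⟩ := hcon (2 * n)
    obtain ⟨y, hy, i, hi⟩ := mem_language.1 hv
    refine ⟨_, hs.translate_mem hy (i + n), fun h => hv2 ?_⟩
    rw [word_translate, show -(n : ℤ) + (i + n) = i by ring] at h
    rw [← hi]
    exact h.trans (word_infix_word y le_rfl (by push_cast; omega))
  have hZc : ∀ n, IsClosed (Z n) := fun n =>
    hs.1.isClosed.inter (isClopen_word_eq (-n) (2 * n) {w | ¬ u <:+: w}).1
  have hZm : ∀ n, Z (n + 1) ⊆ Z n := by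
    intro n y hy
    refine ⟨hy.1, fun h => hy.2 (h.trans (word_infix_word y (by push_cast; omega) ?_))⟩
    push_cast; omega
  obtain ⟨y, hy⟩ := IsCompact.nonempty_iInter_of_sequence_nonempty_isCompact_isClosed Z hZm hZne
    (hs.1.of_isClosed_subset (hZc 0) (fun _ h => h.1)) hZc
  let W : Set (ℤ → ℕ) := {y ∈ Y | ∀ i n, ¬ u <:+: word y i n}
  have hyW : y ∈ W := by
    rw [Set.mem_iInter] at hy
    refine ⟨(hy 0).1, fun i n h => (hy (i.natAbs + n)).2 (h.trans ?_)⟩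
    have := Int.natCast_natAbs i
    refine word_infix_word y ?_ ?_ <;> push_cast <;> omega
  have hW : IsSubshift W := by
    refine isSubshift_of_translate (hs.1.of_isClosed_subset ?_ fun _ h => h.1) ?_
    · have : W = Y ∩ ⋂ (i : ℤ) (n : ℕ), {x | word x i n ∈ {w | ¬ u <:+: w}} := by
        ext x; simp [W]
      rw [this]
      exact hs.1.isClosed.inter
        (isClosed_iInter fun i => isClosed_iInter fun n => (isClopen_word_eq i n _).1)
    · intro x hx c
      refine ⟨hs.translate_mem hx.1 c, fun i n => ?_⟩
      rw [word_translate]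
      exact hx.2 _ _
  rcases hmin W hW (fun _ h => h.1) with h | h
  · rw [h] at hyW; exact hyW
  · obtain ⟨z, hz, i, hi⟩ := mem_language.1 hu
    rw [← h] at hz
    exact hz.2 i u.length (by rw [hi])

/-- By Baire, a countable `Y` has an isolated point `y`. The points whose orbit misses `y` form a
proper subshift, hence none exist; by compactness finitely many translates of `{y}` cover `Y`, which
is then finite. -/
theorem IsMinimalSubshift.not_countable {Y : Set (ℤ → ℕ)} (hY : IsMinimalSubshift Y)
    (hinf : Y.Infinite) : ¬ Y.Countable := by
  intro hc
  obtain ⟨hs, hne, hmin⟩ := hY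
  have : CompactSpace Y := isCompact_iff_compactSpace.1 hs.1
  have : Nonempty Y := hne.to_subtype
  have : Countable Y := hc.to_subtype
  obtain ⟨y, hy⟩ := nonempty_interior_of_iUnion_of_closed (f := fun y : Y => ({y} : Set Y))
    (fun y => isClosed_singleton) (Set.iUnion_of_singleton Y)
  have hop : IsOpen ({y} : Set Y) := by
    obtain ⟨z, hz⟩ := hy
    obtain rfl : z = y := Set.mem_singleton_iff.1 (interior_subset hz)
    rw [isOpen_iff_mem_nhds]
    rintro _ rfl
    exact mem_interior_iff_mem_nhds.1 hz
  let τ : ℤ → Y → Y := fun c x => ⟨_, hs.translate_mem x.2 c⟩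
  have hτ : ∀ c, Continuous (τ c) := fun c =>
    ((continuous_translate c).comp continuous_subtype_val).subtype_mk _
  have hcov : (Set.univ : Set Y) ⊆ ⋃ c, τ c ⁻¹' {y} := by
    by_contra hne
    obtain ⟨z, -, hz⟩ := Set.not_subset.1 hne
    let W : Set (ℤ → ℕ) := Subtype.val '' (⋃ c, τ c ⁻¹' {y})ᶜ
    have hW : IsSubshift W := by
      refine isSubshift_of_translate ?_ ?_
      · exact ((isOpen_iUnion fun c => hop.preimage (hτ c)).isClosed_compl.isCompact).image
          continuous_subtype_val
      · rintro _ ⟨x, hx, rfl⟩ c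
        refine ⟨τ c x, ?_, rfl⟩
        simp only [Set.mem_compl_iff, Set.mem_iUnion, not_exists] at hx ⊢
        intro d hd
        refine hx (d + c) ?_
        rw [Set.mem_preimage, Set.mem_singleton_iff] at hd ⊢
        rw [← hd]
        ext i
        simp [τ, add_assoc]
    rcases hmin W hW (by rintro _ ⟨x, -, rfl⟩; exact x.2) with h | h
    · have : z.1 ∈ W := ⟨z, hz, rfl⟩
      rw [h] at this
      exact this
    · have h3 : y.1 ∈ W := h.symm ▸ y.2
      obtain ⟨x, hx, hxy⟩ := h3
      have h4 : x = y := Subtype.ext hxy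
      subst h4
      refine hx (Set.mem_iUnion.2 ⟨0, ?_⟩)
      rw [Set.mem_preimage, Set.mem_singleton_iff]
      ext i
      simp [τ]
  obtain ⟨t, ht⟩ := isCompact_univ.elim_finite_subcover _ (fun c => hop.preimage (hτ c)) hcov
  apply hinf
  have hfin : (Set.univ : Set Y).Finite := by
    refine Set.Finite.subset (Set.Finite.biUnion t.finite_toSet fun c _ => ?_) ht
    refine (Set.finite_singleton y).preimage fun a _ b _ hab => ?_
    ext i
    have := congrFun (congrArg Subtype.val hab) (i - c)
    simpa [τ] using this
  exact Set.finite_coe_iff.1 (Set.finite_univ_iff.1 hfin)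

/-! ### Nested words in the language of `Y` -/

/-- A sequence of words over the letters below `N`, each of which is a proper prefix and suffix of
the next, in such a way that the two occurrences do not overlap. -/
structure IsNested (N : ℕ) (p : ℕ → List ℕ) : Prop where
  ne_nil : p 0 ≠ []
  succ : ∀ k, ∃ v, p (k + 1) = p k ++ (v ++ p k)
  lt : ∀ k, ∀ a ∈ p k, a < N

namespace IsNested

variable {N : ℕ} {p : ℕ → List ℕ} (hp : IsNested N p)
include hp

theorem length_lt_succ (k : ℕ) : (p k).length < (p (k + 1)).length := by
  have h0 : ∀ k, p k ≠ [] := fun k => by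
    induction k with
    | zero => exact hp.ne_nil
    | succ k ih => obtain ⟨v, hv⟩ := hp.succ k; simp [hv, ih]
  obtain ⟨v, hv⟩ := hp.succ k
  have := List.length_pos_iff.2 (h0 k)
  rw [hv]
  simp
  omega

theorem length_strictMono : StrictMono fun k => (p k).length :=
  strictMono_nat_of_lt_succ hp.length_lt_succ

theorem le_length (k : ℕ) : k ≤ (p k).length := hp.length_strictMono.id_le k

theorem prefix_of_le {k l : ℕ} (h : k ≤ l) : p k <+: p l := by
  induction h with
  | refl => exact List.prefix_rfl
  | step _ ih =>
    obtain ⟨v, hv⟩ := hp.succ _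
    rw [hv]
    exact ih.trans (List.prefix_append _ _)

theorem suffix_of_le {k l : ℕ} (h : k ≤ l) : p k <:+ p l := by
  induction h with
  | refl => exact List.suffix_rfl
  | step _ ih =>
    obtain ⟨v, hv⟩ := hp.succ _
    rw [hv]
    exact ih.trans ((List.suffix_append _ _).trans (List.suffix_append _ _))

end IsNested

theorem IsMinimalSubshift.exists_return {Y : Set (ℤ → ℕ)} (hY : IsMinimalSubshift Y) {u : List ℕ}
    (hu : u ∈ language Y) : ∃ v, u ++ (v ++ u) ∈ language Y := by
  obtain ⟨n, hn⟩ := hY.exists_length_infix hu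
  obtain ⟨y, hy, i, hi⟩ := mem_language.1 hu
  have h1 := hn (word y (i + u.length) n) (word_mem_language hy _ _) (by simp)
  obtain ⟨k, -, hk⟩ := exists_word_of_infix h1
  refine ⟨word y (i + u.length) k, ?_⟩
  have : u ++ (word y (i + u.length) k ++ u) = word y i (u.length + (k + u.length)) := by
    rw [word_add, word_add, hi, hk]
  rw [this]
  exact word_mem_language hy _ _

/-- Given `u` in the language of `Y`, search for the first `v` with `u v u` in the language:
recurrence makes the search succeed, recursiveness makes it effective. -/
theorem IsMinimalSubshift.exists_isNested {Y : Set (ℤ → ℕ)} (hY : IsMinimalSubshift Y)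
    (hr : IsRecursive Y) {N : ℕ} (hN : ∀ y ∈ Y, ∀ i, y i < N) :
    ∃ p : ℕ → List ℕ, Computable p ∧ IsNested N p ∧ ∀ k, p k ∈ language Y := by
  classical
  let d : ℕ → List ℕ := fun n => (Encodable.decode n : Option (List ℕ)).getD []
  have hd : Computable d := Computable.option_getD Computable.decode (Computable.const [])
  -- The second alternative only makes the search total; it never happens along the sequence `p`.
  let P : List ℕ → ℕ → Prop := fun u n => u ++ (d n ++ u) ∈ language Y ∨ u ∉ language Y
  have hext : Computable fun q : List ℕ × ℕ => q.1 ++ (d q.2 ++ q.1) :=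
    Computable.list_append.comp Computable.fst
      (Computable.list_append.comp (hd.comp Computable.snd) Computable.fst)
  have hP : ComputablePred fun q : List ℕ × ℕ => P q.1 q.2 := by
    refine Computable.computablePred ?_
    refine (Primrec.or.to_comp.comp (hr.decide.comp hext)
      (Primrec.not.to_comp.comp (hr.decide.comp Computable.fst))).of_eq fun q => ?_
    simp [P]
  have hex : ∀ u, ∃ n, P u n := by
    intro u
    by_cases hu : u ∈ language Y
    · obtain ⟨v, hv⟩ := hY.exists_return hu
      exact ⟨Encodable.encode v, Or.inl (by simpa [d] using hv)⟩
    · exact ⟨0, Or.inr hu⟩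
  have hf := hd.comp (Computable.find hP hex)
  obtain ⟨y, hy⟩ := hY.2.1
  let p : ℕ → List ℕ := fun k => Nat.rec (motive := fun _ => List ℕ) [y 0]
    (fun _ u => u ++ (d (Nat.find (hex u)) ++ u)) k
  have hpY : ∀ k, p k ∈ language Y := by
    intro k
    induction k with
    | zero => simpa [p, word_one] using word_mem_language hy 0 1
    | succ k ih => exact (Nat.find_spec (hex (p k))).resolve_right (not_not_intro ih)
  refine ⟨p, ?_, ⟨by simp [p], fun k => ⟨_, rfl⟩, fun k a ha => ?_⟩, hpY⟩
  · have h2 : Computable fun q : ℕ × ℕ × List ℕ => q.2.2 :=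
      Computable.snd.comp Computable.snd
    exact Computable.nat_rec Computable.id (Computable.const [y 0])
      (Computable.list_append.comp h2 (Computable.list_append.comp (hf.comp h2) h2)).to₂
  · obtain ⟨z, hz, i, hi⟩ := mem_language.1 (hpY k)
    rw [← hi] at ha
    obtain ⟨b, -, rfl⟩ := List.mem_map.1 ha
    exact hN z hz _

/-! ### Factors of concatenations -/

/-- A factor that is neither inside `x` nor inside `y` overhangs the block `m` by less than its own
length on each side, so it cannot leave `x'` or `y'`. -/
theorem infix_append_cases {u x m y x' y' : List ℕ} (h : u <:+: x ++ (m ++ y)) (hm : m ≠ [])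
    (hx : x' <:+ x) (hy : y' <+: y) (lx : u.length ≤ x'.length) (ly : u.length ≤ y'.length) :
    u <:+: x ∨ u <:+: y ∨ u <:+: x' ++ (m ++ y') := by
  obtain ⟨x0, rfl⟩ := hx
  obtain ⟨y0, rfl⟩ := hy
  have hm := List.length_pos_iff.2 hm
  obtain ⟨s, t, h⟩ := h
  have hlen := congrArg List.length h
  simp only [List.length_append] at hlen
  by_cases h1 : s.length + u.length ≤ (x0 ++ x').length
  · left
    have : s ++ u <+: x0 ++ x' := by
      refine List.prefix_of_prefix_length_le (l₃ := s ++ u ++ t) ⟨t, rfl⟩ ?_ (by simpa using h1)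
      exact h ▸ List.prefix_append _ _
    exact (List.suffix_append s u).isInfix.trans this.isInfix
  by_cases h2 : (x0 ++ x').length + m.length ≤ s.length
  · right; left
    have : u ++ t <:+ y' ++ y0 := by
      refine List.suffix_of_suffix_length_le (l₃ := s ++ u ++ t) ⟨s, by simp⟩ ?_ ?_
      · rw [h, ← List.append_assoc]
        exact List.suffix_append _ _
      · simp at h2 ⊢; omega
    exact (List.prefix_append u t).isInfix.trans this.isInfix
  · right; right
    simp only [List.length_append] at h1 h2
    have e1 : s = x0 ++ s.drop x0.length := by
      have : x0 <+: s := by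
        refine List.prefix_of_prefix_length_le (l₃ := s ++ u ++ t) ?_ ⟨u ++ t, by simp⟩ (by omega)
        rw [h]
        exact ⟨x' ++ (m ++ (y' ++ y0)), by simp⟩
      obtain ⟨r, rfl⟩ := this
      simp
    rw [e1] at h
    have h3 : s.drop x0.length ++ u ++ t = x' ++ (m ++ (y' ++ y0)) := by
      simpa using h
    have : s.drop x0.length ++ u <+: x' ++ (m ++ y') := by
      refine List.prefix_of_prefix_length_le (l₃ := s.drop x0.length ++ u ++ t) ⟨t, rfl⟩ ?_ ?_
      · rw [h3]
        exact ⟨y0, by simp⟩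
      · simp; omega
    exact (List.suffix_append _ u).isInfix.trans this.isInfix

theorem infix_append_append {x m y x' y' : List ℕ} (hx : x' <:+ x) (hy : y' <+: y) :
    x' ++ (m ++ y') <:+: x ++ (m ++ y) := by
  obtain ⟨x0, rfl⟩ := hx
  obtain ⟨y0, rfl⟩ := hy
  exact ⟨x0, y0, by simp⟩

/-- The first letter which is at least `N` splits a word in a unique way. -/
theorem append_cons_inj {N : ℕ} {u u' r r' : List ℕ} {m m' : ℕ} (hu : ∀ a ∈ u, a < N)
    (hu' : ∀ a ∈ u', a < N) (hm : N ≤ m) (hm' : N ≤ m') (h : u ++ m :: r = u' ++ m' :: r') :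
    u = u' ∧ m = m' ∧ r = r' := by
  induction u generalizing u' with
  | nil =>
    cases u' with
    | nil => simpa using h
    | cons b u' =>
      have := hu' b (by simp)
      simp at h
      omega
  | cons a u ih =>
    cases u' with
    | nil =>
      have := hu a (by simp)
      simp at h
      omega
    | cons b u' =>
      simp only [List.cons_append, List.cons.injEq] at h
      obtain ⟨e1, e2, e3⟩ := ih (fun c hc => hu c (by simp [hc])) (fun c hc => hu' c (by simp [hc]))
        h.2
      simp [h.1, e1, e2, e3]

/-- Factors of `x ++ m :: y` avoiding `m` are factors of `x` or of `y`. -/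
theorem infix_append_cons_of_not_mem {u x y : List ℕ} {m : ℕ} (h : u <:+: x ++ m :: y)
    (hm : m ∉ u) : u <:+: x ∨ u <:+: y := by
  obtain ⟨s, t, h⟩ := h
  rw [List.append_assoc, List.append_eq_append_iff] at h
  rcases h with ⟨c, rfl, h2⟩ | ⟨c, rfl, h2⟩
  · left
    rw [List.append_eq_append_iff] at h2
    rcases h2 with ⟨d, rfl, -⟩ | ⟨d, rfl, h4⟩
    · exact ⟨s, d, by simp⟩
    · cases d with
      | nil => exact ⟨s, [], by simp⟩
      | cons b d =>
        simp only [List.cons_append, List.cons.injEq] at h4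
        exact absurd (by simp [h4.1]) hm
  · cases c with
    | nil =>
      cases u with
      | nil => exact Or.inl (List.nil_infix)
      | cons b u =>
        simp only [List.nil_append, List.cons_append, List.cons.injEq] at h2
        exact absurd (by simp [h2.1]) hm
    | cons b c =>
      simp only [List.cons_append, List.cons.injEq] at h2
      exact Or.inr ⟨c, t, by simp [h2.2]⟩

/-! ### The words `level` -/

/-- The last part of `level N p T (s + 1)`: the word `x`, followed by words `q` and `w`
separated by markers. -/
def separated (N : ℕ) (q w : List ℕ) : List ℕ :=
  w ++ (N + 3) :: (q ++ (N + 4) :: (w ++ (N + 3) :: (q ++ (N + 5) :: w)))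

/-- The signal carried by stage `s`: the word `p a` between the markers `N + 1` and `N + 2`, the
word `v`, the marker `N + 3`, the word `q` and a marker telling the truth value of `b`. -/
def signal (N : ℕ) (u v q : List ℕ) (b : Bool) : List ℕ :=
  (N + 1) :: (u ++ (N + 2) :: (v ++ (N + 3) :: (q ++ [bif b then N + 4 else N + 5])))

/-- The words from which the quasiminimal subshift is built. Each is a proper prefix and suffix of
the next one. The letters `N, …, N + 5` are markers. The marker `N + 4` after a word `p s` says that
`T s` holds. -/
def level (N : ℕ) (p : ℕ → List ℕ) (T : ℕ → Bool) : ℕ → List ℕ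
  | 0 => [N]
  | s + 1 =>
    have : s.unpair.1 < s + 1 := Nat.lt_succ_of_le (Nat.unpair_left_le s)
    level N p T s ++ N :: (level N p T s ++
      (signal N (p s.unpair.1) (level N p T s.unpair.1) (p s) (T s) ++
        separated N (p s) (level N p T s)))

section

variable {N : ℕ} {p : ℕ → List ℕ} {T : ℕ → Bool}

theorem level_zero : level N p T 0 = [N] := by rw [level]

theorem level_succ (s : ℕ) : level N p T (s + 1) =
    level N p T s ++ N :: (level N p T s ++
      (signal N (p s.unpair.1) (level N p T s.unpair.1) (p s) (T s) ++
        separated N (p s) (level N p T s))) := by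
  rw [level]

theorem level_prefix_of_le {k l : ℕ} (h : k ≤ l) : level N p T k <+: level N p T l := by
  induction h with
  | refl => exact List.prefix_rfl
  | step _ ih => rw [level_succ]; exact ih.trans (List.prefix_append _ _)

theorem suffix_separated (q w : List ℕ) : w <:+ separated N q w :=
  ⟨w ++ (N + 3) :: (q ++ (N + 4) :: (w ++ (N + 3) :: (q ++ [N + 5]))), by simp [separated]⟩

theorem prefix_separated (q w : List ℕ) : w <+: separated N q w := List.prefix_append _ _

theorem level_suffix_of_le {k l : ℕ} (h : k ≤ l) : level N p T k <:+ level N p T l := by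
  induction h with
  | refl => exact List.suffix_rfl
  | step _ ih =>
    rw [level_succ]
    exact ih.trans ((suffix_separated _ _).trans ((List.suffix_append _ _).trans
      ((List.suffix_append _ _).trans ((List.suffix_cons _ _).trans (List.suffix_append _ _)))))

theorem level_infix_of_le {k l : ℕ} (h : k ≤ l) : level N p T k <:+: level N p T l :=
  (level_prefix_of_le h).isInfix

theorem succ_le_length_level (s : ℕ) : s + 1 ≤ (level N p T s).length := by
  induction s with
  | zero => simp [level_zero]
  | succ s ih => rw [level_succ, List.length_append, List.length_cons, List.length_append]; omega

theorem lt_of_mem_level (hp : IsNested N p) {s a : ℕ} (h : a ∈ level N p T s) : a < N + 6 := by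
  induction s using Nat.strong_induction_on with
  | _ s ih =>
    cases s with
    | zero => simp [level_zero] at h; omega
    | succ s =>
      have h1 := ih s (by omega)
      have h2 := ih s.unpair.1 (Nat.lt_succ_of_le (Nat.unpair_left_le s))
      have h3 := hp.lt s a
      have h4 := hp.lt s.unpair.1 a
      simp only [level_succ, signal, separated, List.mem_append, List.mem_cons,
        List.not_mem_nil] at h
      cases T s <;> grind

/-- Words without markers in `level N p T s` are words of `p`. -/
theorem infix_level_of_lt {L : Set (List ℕ)} (hL : ∀ u w, u <:+: w → w ∈ L → u ∈ L)
    (hpL : ∀ k, p k ∈ L) {s : ℕ} {u : List ℕ} (hu : ∀ a ∈ u, a < N) (h : u <:+: level N p T s) :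
    u ∈ L := by
  have h0 : ∀ m, N ≤ m → m ∉ u := fun m hm h => absurd (hu m h) (by omega)
  have hnil : [] ∈ L := hL _ _ List.nil_infix (hpL 0)
  induction s using Nat.strong_induction_on with
  | _ s ih =>
    cases s with
    | zero =>
      rw [level_zero] at h
      rcases infix_append_cons_of_not_mem (x := []) (y := []) h (h0 _ le_rfl) with h | h <;>
      · rw [List.infix_nil.1 h]; exact hnil
    | succ s =>
      have h1 := ih s (by omega)
      have h2 := ih s.unpair.1 (Nat.lt_succ_of_le (Nat.unpair_left_le s))
      have h3 : ∀ k, u <:+: p k → u ∈ L := fun k hk => hL _ _ hk (hpL k)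
      simp only [level_succ, signal, separated, List.append_assoc, List.cons_append,
        List.nil_append] at h
      rcases infix_append_cons_of_not_mem h (h0 _ (by omega)) with h | h
      · exact h1 h
      rcases infix_append_cons_of_not_mem h (h0 _ (by omega)) with h | h
      · exact h1 h
      rcases infix_append_cons_of_not_mem h (h0 _ (by omega)) with h | h
      · exact h3 _ h
      rcases infix_append_cons_of_not_mem h (h0 _ (by omega)) with h | h
      · exact h2 h
      rcases infix_append_cons_of_not_mem h (h0 _ (by cases T s <;> simp)) with h | h
      · exact h3 _ h
      rcases infix_append_cons_of_not_mem h (h0 _ (by omega)) with h | h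
      · exact h1 h
      rcases infix_append_cons_of_not_mem h (h0 _ (by omega)) with h | h
      · exact h3 _ h
      rcases infix_append_cons_of_not_mem h (h0 _ (by omega)) with h | h
      · exact h1 h
      rcases infix_append_cons_of_not_mem h (h0 _ (by omega)) with h | h
      · exact h3 _ h
      · exact h1 h

end

/-! ### Markers are close to copies of each level -/

/-- Every marker of `w` lies in an occurrence of a word which contains `v` and extends at most `R`
letters to either side of the marker. -/
def Near (N R : ℕ) (v w : List ℕ) : Prop :=
  ∀ α m β, w = α ++ m :: β → N ≤ m → ∃ α' β', α' <:+ α ∧ β' <+: β ∧ α'.length ≤ R ∧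
    β'.length ≤ R ∧ v <:+: α' ++ m :: β'

section

variable {N R : ℕ} {v x y : List ℕ}

theorem near_self (h : v.length ≤ R) : Near N R v v := by
  rintro α m β rfl -
  simp only [List.length_append, List.length_cons] at h
  exact ⟨α, β, List.suffix_rfl, List.prefix_rfl, by omega, by omega, List.infix_rfl⟩

theorem near_of_lt (h : ∀ a ∈ x, a < N) : Near N R v x := by
  rintro α m β rfl hm
  exact absurd (h m (by simp)) (by omega)

theorem Near.append (hx : Near N R v x) (hy : Near N R v y) : Near N R v (x ++ y) := by
  intro α m β h hm
  rw [List.append_eq_append_iff] at h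
  rcases h with ⟨c, rfl, h2⟩ | ⟨c, rfl, h2⟩
  · obtain ⟨α', β', h3, h4, h5⟩ := hy c m β h2 hm
    exact ⟨α', β', h3.trans (List.suffix_append _ _), h4, h5⟩
  · cases c with
    | nil =>
      obtain ⟨α', β', h3, h4, h5⟩ := hy [] m β h2.symm hm
      exact ⟨α', β', h3.trans List.nil_suffix, h4, h5⟩
    | cons b c =>
      simp only [List.cons_append, List.cons.injEq] at h2
      obtain ⟨rfl, rfl⟩ := h2
      obtain ⟨α', β', h3, h4, h5⟩ := hx α m c rfl hm
      exact ⟨α', β', h3, h4.trans (List.prefix_append _ _), h5⟩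

/-- The markers of `y` are served by the copy of `v` that ends `x`. -/
theorem Near.append_left (hx : Near N R v x) (hv : v <:+ x) (h : v.length + y.length ≤ R) :
    Near N R v (x ++ y) := by
  intro α m β e hm
  rw [List.append_eq_append_iff] at e
  have key : ∀ c, y = c ++ m :: β → ∃ α' β', α' <:+ x ++ c ∧ β' <+: β ∧ α'.length ≤ R ∧
      β'.length ≤ R ∧ v <:+: α' ++ m :: β' := by
    rintro c rfl
    obtain ⟨x0, rfl⟩ := hv
    refine ⟨v ++ c, [], ⟨x0, by simp⟩, List.nil_prefix, ?_, by simp, ⟨[], c ++ [m], by simp⟩⟩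
    simp at h ⊢
    omega
  rcases e with ⟨c, rfl, h2⟩ | ⟨c, rfl, h2⟩
  · exact key c h2
  · cases c with
    | nil => simpa using key [] h2.symm
    | cons b c =>
      simp only [List.cons_append, List.cons.injEq] at h2
      obtain ⟨rfl, rfl⟩ := h2
      obtain ⟨α', β', h3, h4, h5⟩ := hx α m c rfl hm
      exact ⟨α', β', h3, h4.trans (List.prefix_append _ _), h5⟩

theorem Near.append_cons_left {m : ℕ} (hx : Near N R v x) (hy : Near N R v y) (hv : v <:+ x)
    (h : v.length + 1 ≤ R) : Near N R v (x ++ m :: y) := by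
  have := (hx.append_left (y := [m]) hv h).append hy
  simpa using this

theorem Near.cons {m : ℕ} (hy : Near N R v y) (hv : v <+: y) (h : v.length ≤ R) :
    Near N R v (m :: y) := by
  intro α m' β e hm
  cases α with
  | nil =>
    simp only [List.nil_append, List.cons.injEq] at e
    obtain ⟨rfl, rfl⟩ := e
    exact ⟨[], v, List.nil_suffix, hv, by simp, h, ⟨[m], [], by simp⟩⟩
  | cons b α =>
    simp only [List.cons_append, List.cons.injEq] at e
    obtain ⟨α', β', h3, h4⟩ := hy α m' β e.2 hm
    exact ⟨α', β', h3.trans (List.suffix_cons _ _), h4⟩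

end

/-- Induction on `t`: every marker in the definition of `level` is adjacent to some level, which
begins and ends with `v` as soon as its index is at least `k`. The exceptions are the markers around
a low level `W_a`, `a < k`, and these belong to a block of bounded length. -/
theorem near_level {N : ℕ} {p : ℕ → List ℕ} {T : ℕ → Bool} (hp : IsNested N p) (k : ℕ) :
    ∃ R, ∀ t, k ≤ t → Near N R (level N p T k) (level N p T t) := by
  set v := level N p T k with hv
  -- A copy of `v` followed by a block `(N+1) p_a (N+2) W_a (N+3)` with `a < k`, whose length is at
  -- most `|p_k| + |v| + 3`.
  let R := v.length + (v.length + (p k).length + 3)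
  refine ⟨R, fun t ht => ?_⟩
  have hR : v.length + 1 ≤ R := by omega
  have hR' : v.length ≤ R := by omega
  induction t using Nat.strong_induction_on with
  | _ t ih =>
    cases t with
    | zero =>
      obtain rfl : k = 0 := by omega
      exact near_self hR'
    | succ s =>
      rcases ht.eq_or_lt with rfl | ht
      · exact near_self hR'
      have hks : k ≤ s := by omega
      have hW := ih s (by omega) hks
      have hpre : v <+: level N p T s := level_prefix_of_le hks
      have hsuf : v <:+ level N p T s := level_suffix_of_le hks
      have hps : Near N R v (p s) := near_of_lt (hp.lt s)
      have has := Nat.unpair_left_le s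
      have hsep : Near N R v (separated N (p s) (level N p T s)) :=
        hW.append_cons_left (hps.append ((hW.append_cons_left (hps.append
          (hW.cons hpre hR')) hsuf hR).cons (hpre.trans (List.prefix_append _ _)) hR')) hsuf hR
      have hend : ∀ m, Near N R v (p s ++ m :: separated N (p s) (level N p T s)) := fun m =>
        hps.append (hsep.cons (hpre.trans (prefix_separated _ _)) hR')
      have key : Near N R v (level N p T s ++
          (signal N (p s.unpair.1) (level N p T s.unpair.1) (p s) (T s) ++
            separated N (p s) (level N p T s))) := by
        -- If `k ≤ a`, the inner `W_a` supplies copies of `v` at both ends; otherwise the block up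
        -- to `N + 3` is short and is attached to the preceding `W_s`.
        by_cases hak : k ≤ s.unpair.1
        · have hA := ih s.unpair.1 (by omega) hak
          have hpre' : v <+: level N p T s.unpair.1 := level_prefix_of_le hak
          have hsuf' : v <:+ level N p T s.unpair.1 := level_suffix_of_le hak
          have := hW.append_cons_left (m := N + 1) ((near_of_lt (hp.lt s.unpair.1)).append
            ((hA.append_cons_left (m := N + 3) (hend (bif T s then N + 4 else N + 5)) hsuf' hR).cons
              (m := N + 2) (hpre'.trans (List.prefix_append _ _)) hR')) hsuf hR
          simpa [signal] using this
        · have h1 : (level N p T s.unpair.1).length ≤ v.length :=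
            (level_infix_of_le (by omega)).length_le
          have h2 : (p s.unpair.1).length ≤ (p k).length :=
            hp.length_strictMono.monotone (show s.unpair.1 ≤ k by omega)
          have := (hW.append_left (y := (N + 1) :: (p s.unpair.1 ++ (N + 2) ::
            (level N p T s.unpair.1 ++ [N + 3]))) hsuf (by simp [R]; omega)).append
              (hend (bif T s then N + 4 else N + 5))
          simpa [signal] using this
      rw [level_succ]
      exact hW.append_cons_left key hsuf hR

/-! ### Signals and their unique reading -/

/-- In `level N p T s`, every marker `N + 1` starts a signal. -/
def Signals (N : ℕ) (p : ℕ → List ℕ) (T : ℕ → Bool) (w : List ℕ) : Prop :=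
  ∀ α β, w = α ++ (N + 1) :: β → ∃ s γ, (N + 1) :: β =
    signal N (p s.unpair.1) (level N p T s.unpair.1) (p s) (T s) ++ γ

section

variable {N : ℕ} {p : ℕ → List ℕ} {T : ℕ → Bool} {x y : List ℕ}

theorem signals_of_lt (h : ∀ a ∈ x, a < N) : Signals N p T x := by
  rintro α β rfl
  exact absurd (h (N + 1) (by simp)) (by omega)

theorem Signals.append (hx : Signals N p T x) (hy : Signals N p T y) :
    Signals N p T (x ++ y) := by
  intro α β h
  rw [List.append_eq_append_iff] at h
  rcases h with ⟨c, rfl, h2⟩ | ⟨c, rfl, h2⟩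
  · exact hy c β h2
  · cases c with
    | nil => exact hy [] β h2.symm
    | cons b c =>
      simp only [List.cons_append, List.cons.injEq] at h2
      obtain ⟨rfl, rfl⟩ := h2
      obtain ⟨s, γ, h3⟩ := hx α c rfl
      exact ⟨s, γ ++ y, by rw [← List.cons_append, h3, List.append_assoc]⟩

theorem Signals.cons {m : ℕ} (hy : Signals N p T y) (hm : m ≠ N + 1) :
    Signals N p T (m :: y) := by
  intro α β h
  cases α with
  | nil => simp at h; omega
  | cons b α =>
    simp only [List.cons_append, List.cons.injEq] at h
    exact hy α β h.2

/-- The marker `N + 1` is written only at the head of a signal; any other occurrence is inside a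
copy of an earlier level. -/
theorem signals_level (hp : IsNested N p) (t : ℕ) : Signals N p T (level N p T t) := by
  have hnil : Signals N p T [] := signals_of_lt (by simp)
  induction t using Nat.strong_induction_on with
  | _ t ih =>
    cases t with
    | zero => rw [level_zero]; exact hnil.cons (by omega)
    | succ s =>
      have hW := ih s (by omega)
      have hA := ih s.unpair.1 (Nat.lt_succ_of_le (Nat.unpair_left_le s))
      have hps : ∀ s, Signals N p T (p s) := fun s => signals_of_lt (hp.lt s)
      rw [level_succ]
      refine hW.append ((hW.append (Signals.append ?_ ?_)).cons (by omega))
      · intro α β h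
        cases α with
        | nil => exact ⟨s, [], by simpa using h.symm⟩
        | cons b α =>
          simp only [signal, List.cons_append, List.cons.injEq] at h
          refine Signals.append (hps _) ((hA.append (((hps s).append
            (hnil.cons ?_)).cons (by omega))).cons (by omega)) α β h.2
          cases T s <;> simp
      · exact hW.append ((((hps s).append ((hW.append (((hps s).append
          (hW.cons (by omega))).cons (by omega))).cons (by omega)))).cons (by omega))

/-- The word `signal N (p n) (level N p T n) v true` occurs only if `T` sends `n` at some
stage. -/
theorem exists_of_signal_infix (hp : IsNested N p) {n t : ℕ} {v : List ℕ} (hv : ∀ a ∈ v, a < N)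
    (h : signal N (p n) (level N p T n) v true <:+: level N p T t) :
    ∃ s, s.unpair.1 = n ∧ T s = true := by
  obtain ⟨α, δ, h⟩ := h
  obtain ⟨s, γ, h1⟩ := signals_level hp t α _ (by rw [← h, signal, List.append_assoc,
    List.cons_append])
  simp only [signal, List.append_assoc, List.cons_append, List.cons.injEq, true_and] at h1
  -- Both readings start with a marker-free word up to the next marker, so `p n = p s.unpair.1`.
  -- Lengths in `p` are strictly increasing, which recovers `n`; the level that follows is then the
  -- same on both sides and cancels.
  obtain ⟨h2, -, h3⟩ := append_cons_inj (hp.lt _) (hp.lt _) (by omega) (by omega) h1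
  have h4 : n = s.unpair.1 := hp.length_strictMono.injective (congrArg List.length h2)
  subst h4
  have h5 := List.append_cancel_left h3
  simp only [List.cons.injEq, true_and] at h5
  obtain ⟨-, h6, -⟩ := append_cons_inj hv (hp.lt _) (by simp) (by cases T s <;> simp) h5
  refine ⟨s, rfl, ?_⟩
  cases hT : T s
  · simp [hT] at h6
  · rfl

theorem signal_infix_level (s : ℕ) :
    signal N (p s.unpair.1) (level N p T s.unpair.1) (p s) (T s) <:+: level N p T (s + 1) := by
  rw [level_succ]
  exact ⟨level N p T s ++ N :: level N p T s, separated N (p s) (level N p T s), by simp⟩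

theorem infix_level_succ (s : ℕ) : p s <:+: level N p T (s + 1) :=
  List.IsInfix.trans ⟨(N + 1) :: (p s.unpair.1 ++ (N + 2) :: (level N p T s.unpair.1 ++ [N + 3])),
    [bif T s then N + 4 else N + 5], by simp [signal]⟩ (signal_infix_level s)

/-- Short words of the levels occur early. -/
theorem infix_level_bound (hp : IsNested N p) {t : ℕ} {u : List ℕ} (h : u <:+: level N p T t) :
    (∃ k, u <:+: p k) ∨ u <:+: level N p T (Nat.pair u.length u.length + 1) := by
  set l := u.length with hl
  -- Stage `M` carries the signal with first component `l`, so its words show `p l` and `W l` next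
  -- to every kind of marker.
  set M := Nat.pair l l with hM
  have hlM : l ≤ M := Nat.left_le_pair l l
  have hMl : M.unpair.1 = l := by rw [hM, Nat.unpair_pair]
  let W := level N p T
  have hpl := hp.le_length l
  have hwl : l ≤ (W l).length :=
    (Nat.le_succ l).trans (succ_le_length_level l)
  have hpre : ∀ {s}, l ≤ s → W l <+: W s := fun h => level_prefix_of_le h
  have hsuf : ∀ {s}, l ≤ s → W l <:+ W s := fun h => level_suffix_of_le h
  induction t using Nat.strong_induction_on with
  | _ t ih =>
    by_cases ht : t ≤ M + 1
    · exact Or.inr (h.trans (level_infix_of_le ht))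
    obtain ⟨s, rfl⟩ : ∃ s, t = s + 1 := ⟨t - 1, by omega⟩
    have hls : l ≤ s := by omega
    have hW := ih s (by omega)
    have has := Nat.unpair_left_le s
    have hA := ih s.unpair.1 (by omega)
    have hM1 := level_succ (N := N) (p := p) (T := T) M
    rw [hMl] at hM1
    have hP : ∀ k, u <:+: p k → (∃ k, u <:+: p k) ∨ u <:+: level N p T (M + 1) :=
      fun k hk => Or.inl ⟨k, hk⟩
    -- `d0` to `d5` list the junctions visible through a window of length `l`: a marker with the end
    -- of a long block before it and the start of one after it.
    have d0 : W l ++ ([N] ++ W l) <:+: W (M + 1) := by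
      refine (infix_append_append (hsuf hlM) (hpre hlM)).trans ?_
      exact ⟨[], signal N (p l) (level N p T l) (p M) (T M) ++ separated N (p M) (level N p T M),
        by simp [W, hM1]⟩
    have d1 : W l ++ ([N + 1] ++ p l) <:+: W (M + 1) := by
      refine (infix_append_append (hsuf hlM) List.prefix_rfl).trans ?_
      exact ⟨W M ++ [N], (N + 2) :: (W l ++ (N + 3) :: (p M ++ (bif T M then N + 4 else N + 5) ::
        separated N (p M) (W M))), by simp [W, hM1, signal]⟩
    have d2 : p l ++ ([N + 2] ++ W l) <:+: W (M + 1) :=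
      ⟨W M ++ N :: (W M ++ [N + 1]), (N + 3) :: (p M ++ (bif T M then N + 4 else N + 5) ::
        separated N (p M) (W M)), by simp [W, hM1, signal]⟩
    have d3 : W l ++ ([N + 3] ++ p l) <:+: W (M + 1) := by
      refine (infix_append_append List.suffix_rfl (hp.prefix_of_le hlM)).trans ?_
      exact ⟨W M ++ N :: (W M ++ (N + 1) :: (p l ++ [N + 2])),
        (bif T M then N + 4 else N + 5) :: separated N (p M) (W M), by simp [W, hM1, signal]⟩
    have d4 : p l ++ ([N + 4] ++ W l) <:+: W (M + 1) := by
      refine (infix_append_append (hp.suffix_of_le hlM) (hpre hlM)).trans ?_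
      exact ⟨W M ++ N :: (W M ++ (signal N (p l) (level N p T l) (p M) (T M) ++ (W M ++ [N + 3]))),
        (N + 3) :: (p M ++ (N + 5) :: W M), by simp [W, hM1, separated]⟩
    have d5 : p l ++ ([N + 5] ++ W l) <:+: W (M + 1) := by
      refine (infix_append_append (hp.suffix_of_le hlM) (hpre hlM)).trans ?_
      exact ⟨W M ++ N :: (W M ++ (signal N (p l) (level N p T l) (p M) (T M) ++ (W M ++ (N + 3) ::
        (p M ++ (N + 4) :: (W M ++ [N + 3]))))), [], by simp [W, hM1, separated]⟩
    -- The junction after a late signal is already present whichever value `T s` takes.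
    have dT : p l ++ ([bif T s then N + 4 else N + 5] ++ W l) <:+: W (M + 1) := by
      cases T s
      · exact d5
      · exact d4
    have hsep : u <:+: separated N (p s) (level N p T s) →
        (∃ k, u <:+: p k) ∨ u <:+: level N p T (M + 1) := by
      intro h
      rcases infix_append_cases (m := [N + 3]) h (by simp) (hsuf hls)
        ((hp.prefix_of_le hls).trans (List.prefix_append _ _)) hwl hpl with h | h | h
      · exact hW h
      · rcases infix_append_cases (m := [N + 4]) h (by simp) (hp.suffix_of_le hls)
          ((hpre hls).trans (List.prefix_append _ _)) hpl hwl with h | h | h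
        · exact hP _ h
        · rcases infix_append_cases (m := [N + 3]) h (by simp) (hsuf hls)
            ((hp.prefix_of_le hls).trans (List.prefix_append _ _)) hwl hpl with h | h | h
          · exact hW h
          · rcases infix_append_cases (m := [N + 5]) h (by simp) (hp.suffix_of_le hls)
              (hpre hls) hpl hwl with h | h | h
            · exact hP _ h
            · exact hW h
            · exact Or.inr (h.trans d5)
          · exact Or.inr (h.trans d3)
        · exact Or.inr (h.trans d4)
      · exact Or.inr (h.trans d3)
    have hend : u <:+: p s ++ (bif T s then N + 4 else N + 5) ::
        separated N (p s) (level N p T s) →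
        (∃ k, u <:+: p k) ∨ u <:+: level N p T (M + 1) := by
      intro h
      rcases infix_append_cases (m := [_]) h (by simp) (hp.suffix_of_le hls)
        ((hpre hls).trans (prefix_separated _ _)) hpl hwl with h | h | h
      · exact hP _ h
      · exact hsep h
      · exact Or.inr (h.trans dT)
    rw [level_succ] at h
    rcases infix_append_cases (m := [N]) h (by simp) (hsuf hls)
      ((hpre hls).trans (List.prefix_append _ _)) hwl hwl with h | h | h
    · exact hW h
    · by_cases hal : l ≤ s.unpair.1
      · simp only [signal, List.append_assoc, List.cons_append, List.nil_append] at h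
        rcases infix_append_cases (m := [N + 1]) h (by simp) (hsuf hls)
          ((hp.prefix_of_le hal).trans (List.prefix_append _ _)) hwl hpl with h | h | h
        · exact hW h
        · rcases infix_append_cases (m := [N + 2]) h (by simp) (hp.suffix_of_le hal)
            ((hpre hal).trans (List.prefix_append _ _)) hpl hwl with h | h | h
          · exact hP _ h
          · rcases infix_append_cases (m := [N + 3]) h (by simp) (hsuf hal)
              ((hp.prefix_of_le hls).trans (List.prefix_append _ _)) hwl hpl with h | h | h
            · exact hA h
            · exact hend h
            · exact Or.inr (h.trans d3)
          · exact Or.inr (h.trans d2)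
        · exact Or.inr (h.trans d1)
      · let a := s.unpair.1
        -- When `a < l`, the words `p a` and `W a` may be too short to be cut at, so the whole
        -- beginning of the signal is one middle block. It occurs in the same surroundings at stage
        -- `Nat.pair a l`, which is at most `M`.
        let m := (N + 1) :: (p a ++ (N + 2) :: (W a ++ [N + 3]))
        have h' : u <:+: level N p T s ++ (m ++ (p s ++ (bif T s then N + 4 else N + 5) ::
            separated N (p s) (level N p T s))) := by
          simpa [signal, m, W, a] using h
        rcases infix_append_cases h' (by simp [m]) (hsuf hls)
          ((hp.prefix_of_le hls).trans (List.prefix_append _ _)) hwl hpl with h | h | h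
        · exact hW h
        · exact hend h
        · right
          have hr : (Nat.pair a l).unpair.1 = a := by rw [Nat.unpair_pair]
          have hrl : l ≤ Nat.pair a l := Nat.right_le_pair a l
          have hrM : Nat.pair a l ≤ M := (Nat.pair_lt_pair_left l (not_le.1 hal)).le
          have hr1 := level_succ (N := N) (p := p) (T := T) (Nat.pair a l)
          rw [hr] at hr1
          refine h.trans (List.IsInfix.trans ?_ (level_infix_of_le (Nat.succ_le_succ hrM)))
          refine (infix_append_append (hsuf hrl) (hp.prefix_of_le hrl)).trans ?_
          exact ⟨W (Nat.pair a l) ++ [N], (bif T (Nat.pair a l) then N + 4 else N + 5) ::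
            separated N (p (Nat.pair a l)) (W (Nat.pair a l)), by simp [W, m, hr1, signal]⟩
    · exact Or.inr (h.trans d0)

end

/-! ### The subshift: transitivity, its subsystems, its language -/

/-- The subshift of the points all of whose words occur in the words `level N p T s`. -/
def levelShift (N : ℕ) (p : ℕ → List ℕ) (T : ℕ → Bool) : Set (ℤ → ℕ) :=
  pointsOf {u | ∃ s, u <:+: level N p T s}

/-- The point with a marker `N` at the origin, to the left of which it ends in, and to the right of
which it starts with, every `level N p T s`. -/
def levelPoint (N : ℕ) (p : ℕ → List ℕ) (T : ℕ → Bool) : ℤ → ℕ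
  | Int.ofNat 0 => N
  | Int.ofNat (i + 1) => (level N p T i).getD i 0
  | Int.negSucc i => (level N p T i).reverse.getD i 0

section

variable {N : ℕ} {p : ℕ → List ℕ} {T : ℕ → Bool}

theorem getD_eq_of_isPrefix {u v : List ℕ} {k : ℕ} (h : u <+: v) (hk : k < u.length) :
    u.getD k 0 = v.getD k 0 := by
  obtain ⟨t, rfl⟩ := h
  simp [List.getElem?_append_left hk]

/-- Letter `i` may be read in any level long enough to have it, since levels are prefixes of one
another; `W_i` has at least `i + 1` letters. -/
theorem word_levelPoint_right (s : ℕ) :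
    word (levelPoint N p T) 1 (level N p T s).length = level N p T s := by
  apply List.ext_getElem (by simp)
  intro k h1 h2
  have e : (1 + (k : ℤ)) = Int.ofNat (k + 1) := by simp; ring
  rw [getElem_word, e, levelPoint, ← List.getD_eq_getElem _ 0]
  rcases le_total k s with h | h
  · exact getD_eq_of_isPrefix (level_prefix_of_le h) (succ_le_length_level k)
  · exact (getD_eq_of_isPrefix (level_prefix_of_le h) h2).symm

theorem word_levelPoint_left (s : ℕ) :
    word (levelPoint N p T) (-(level N p T s).length) (level N p T s).length =
      level N p T s := by
  apply List.ext_getElem (by simp)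
  intro k h1 h2
  obtain ⟨i, hi⟩ : ∃ i, (level N p T s).length = k + i + 1 :=
    ⟨(level N p T s).length - k - 1, by omega⟩
  have e : (-((level N p T s).length : ℤ) + k) = Int.negSucc i := by
    rw [hi, Int.negSucc_eq]; push_cast; ring
  rw [getElem_word, e, levelPoint]
  have h3 : (level N p T s)[k] = (level N p T s).reverse.getD i 0 := by
    have hir : i < (level N p T s).reverse.length := by simp; omega
    rw [List.getD_eq_getElem _ 0 hir, List.getElem_reverse]
    congr 1
    omega
  rw [h3]
  rcases le_total i s with h | h
  · refine getD_eq_of_isPrefix (List.reverse_prefix.2 (level_suffix_of_le h)) ?_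
    rw [List.length_reverse]
    exact succ_le_length_level i
  · refine (getD_eq_of_isPrefix (List.reverse_prefix.2 (level_suffix_of_le h)) ?_).symm
    rw [List.length_reverse]
    omega

theorem word_levelPoint_center (s : ℕ) :
    word (levelPoint N p T) (-(level N p T s).length) ((level N p T s).length + 1 +
      (level N p T s).length) = level N p T s ++ N :: level N p T s := by
  rw [word_add, word_add, word_levelPoint_left, word_one]
  simp only [neg_add_cancel, Nat.cast_add, Nat.cast_one]
  rw [neg_add_cancel_left, word_levelPoint_right]
  simp [levelPoint]

theorem levelPoint_mem : levelPoint N p T ∈ levelShift N p T := by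
  intro i n
  let s := i.natAbs + n
  refine ⟨s + 1, List.IsInfix.trans ?_ (?_ : level N p T s ++ N :: level N p T s <:+: _)⟩
  · rw [← word_levelPoint_center]
    have := succ_le_length_level (N := N) (p := p) (T := T) s
    have h2 := Int.natCast_natAbs i
    apply word_infix_word <;> push_cast <;> omega
  · rw [level_succ]
    exact ⟨[], _, by simp; rfl⟩

/-- `W_{t+1}` ends with a copy of `W_t` lying beyond its initial copy, and the initial copy has more
than `t` letters, so a large `t` pushes an occurrence past `M`. -/
theorem occurs_right_levelPoint {s : ℕ} {u : List ℕ} (hu : u <:+: level N p T s) (M : ℤ) :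
    ∃ i, M ≤ i ∧ OccursAt u (levelPoint N p T) i := by
  let t := s + M.natAbs
  have h1 : level N p T s <:+ level N p T t := level_suffix_of_le (by omega)
  obtain ⟨r, hr⟩ : ∃ r, level N p T (t + 1) = level N p T t ++ (N :: r) := ⟨_, level_succ t⟩
  have hsuf : level N p T s <:+ N :: r := by
    have h2 : level N p T t <:+ N :: r := by
      have h3 : level N p T t <:+ level N p T (t + 1) := level_suffix_of_le (by omega)
      rw [level_succ] at h3 hr
      have := List.append_cancel_left hr
      rw [← this]
      exact (suffix_separated _ _).trans ((List.suffix_append _ _).trans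
        ((List.suffix_append _ _).trans (List.suffix_cons _ _)))
    exact h1.trans h2
  have h4 := word_levelPoint_right (N := N) (p := p) (T := T) (t + 1)
  rw [hr, List.length_append, word_add] at h4
  have h5 := (List.append_inj h4 (by simp)).2
  rw [← h5] at hsuf
  obtain ⟨k, -, hk⟩ := exists_word_of_infix (hu.trans hsuf.isInfix)
  refine ⟨_, ?_, occursAt_iff.2 hk⟩
  have := succ_le_length_level (N := N) (p := p) (T := T) t
  have h2 := Int.natCast_natAbs M
  omega

theorem occurs_left_levelPoint {s : ℕ} {u : List ℕ} (hu : u <:+: level N p T s) (M : ℤ) :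
    ∃ i, i ≤ M ∧ OccursAt u (levelPoint N p T) i := by
  let t := s + M.natAbs
  have h1 : level N p T s <+: level N p T t := level_prefix_of_le (by omega)
  obtain ⟨r, hr⟩ : ∃ r, level N p T (t + 1) = level N p T t ++ (r ++ level N p T t) := by
    obtain ⟨r, hr⟩ := suffix_separated (N := N) (p t) (level N p T t)
    rw [level_succ, ← hr]
    exact ⟨N :: (level N p T t ++ (signal N (p t.unpair.1) (level N p T t.unpair.1) (p t) (T t) ++
      r)), by simp⟩
  have h4 := word_levelPoint_left (N := N) (p := p) (T := T) (t + 1)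
  have hlen := congrArg List.length hr
  rw [hr, List.length_append, word_add] at h4
  have h5 := (List.append_inj h4 (by simp)).1
  have h6 := hu.trans h1.isInfix
  rw [← h5] at h6
  obtain ⟨k, hk1, hk⟩ := exists_word_of_infix h6
  refine ⟨_, ?_, occursAt_iff.2 hk⟩
  have := succ_le_length_level (N := N) (p := p) (T := T) t
  have h2 := Int.natCast_natAbs M
  simp only [List.length_append] at hlen ⊢
  push_cast
  omega

theorem language_levelShift :
    language (levelShift N p T) = {u | ∃ s, u <:+: level N p T s} := by
  ext u
  constructor
  · intro h
    obtain ⟨x, hx, i, hi⟩ := mem_language.1 h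
    rw [← hi]
    exact hx _ _
  · rintro ⟨s, hs⟩
    obtain ⟨i, -, hi⟩ := occurs_right_levelPoint hs 0
    exact ⟨_, levelPoint_mem, i, hi⟩

theorem isTransitive_levelShift : IsTransitive (levelShift N p T) := by
  refine ⟨_, levelPoint_mem, fun w hw M => ?_⟩
  rw [language_levelShift] at hw
  obtain ⟨s, hs⟩ := hw
  exact ⟨occurs_right_levelPoint hs M, occurs_left_levelPoint hs M⟩

theorem isSubshift_levelShift (hp : IsNested N p) : IsSubshift (levelShift N p T) := by
  refine isSubshift_pointsOf (N := N + 6) ?_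
  rintro w ⟨s, hs⟩ a ha
  exact lt_of_mem_level hp (hs.subset ha)

variable {Y : Set (ℤ → ℕ)}

/-- By uniform recurrence, a word of `Y` occurs in `p m` for large `m`, and `p m` occurs in
`W_{m+1}`. -/
theorem subset_levelShift (hp : IsNested N p) (hpY : ∀ k, p k ∈ language Y)
    (hY : IsMinimalSubshift Y) : Y ⊆ levelShift N p T := by
  intro y hy i n
  obtain ⟨m, hm⟩ := hY.exists_length_infix (word_mem_language hy i n)
  exact ⟨m + 1, (hm _ (hpY m) (hp.le_length m)).trans (infix_level_succ m)⟩

/-- A point of `levelShift N p T` with a marker contains every word of its language. -/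
theorem language_of_marker (hp : IsNested N p) {x : ℤ → ℕ} (hx : x ∈ levelShift N p T) {i : ℤ}
    (hi : N ≤ x i) (k : ℕ) : ∃ j n, level N p T k <:+: word x j n := by
  obtain ⟨R, hR⟩ := near_level (T := T) hp k
  obtain ⟨t, ht⟩ := hx (i - R) (R + 1 + R)
  -- Passing to a level of index at least `k` makes the recurrence bound `R` available.
  have ht' := ht.trans (level_infix_of_le (N := N) (p := p) (T := T) (le_max_left t k))
  obtain ⟨γ, δ, h⟩ := ht'
  rw [word_add, word_add, word_one] at h
  have e : i - R + R = i := by ring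
  rw [e] at h
  obtain ⟨α', β', h1, h2, h3, h4, h5⟩ := hR (max t k) (le_max_right t k) (γ ++ word x (i - R) R)
    (x i) (word x (i - R + ↑(R + 1)) R ++ δ) (by rw [← h]; simp) hi
  refine ⟨i - R, R + 1 + R, h5.trans ?_⟩
  rw [word_add, word_add, word_one, e, List.append_assoc, List.singleton_append]
  have h6 : α' <:+ word x (i - R) R :=
    List.suffix_of_suffix_length_le h1 (List.suffix_append _ _) (by simpa using h3)
  have h7 : β' <+: word x (i - R + ↑(R + 1)) R :=
    List.prefix_of_prefix_length_le h2 (List.prefix_append _ _) (by simpa using h4)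
  exact infix_append_append (m := [x i]) h6 h7

/-- A marker in `Z` forces the full language, hence `Z = X`. Without markers, `Z` lies in `Y` and
minimality applies. Conversely `Y` is proper because `levelPoint` has the marker `N` at the origin.
-/
theorem subshift_levelShift_iff (hp : IsNested N p) (hpY : ∀ k, p k ∈ language Y)
    (hY : IsMinimalSubshift Y) (hN : ∀ y ∈ Y, ∀ i, y i < N) (Z : Set (ℤ → ℕ)) :
    (IsSubshift Z ∧ Z.Nonempty ∧ Z ⊂ levelShift N p T) ↔ Z = Y := by
  constructor
  · rintro ⟨hZ, hne, hss⟩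
    have hlt : ∀ z ∈ Z, ∀ i, z i < N := by
      intro z hz i
      by_contra hi
      refine hss.2 (hZ.subset_of_language_subset fun u hu => ?_)
      rw [language_levelShift] at hu
      obtain ⟨s, hs⟩ := hu
      obtain ⟨j, n, hj⟩ := language_of_marker hp (hss.1 hz) (not_lt.1 hi) s
      exact language_of_infix (word_mem_language hz j n) (hs.trans hj)
    have hZY : Z ⊆ Y := by
      intro z hz
      refine hY.1.mem_of_words fun i n => ?_
      obtain ⟨s, hs⟩ := hss.1 hz i n
      refine infix_level_of_lt (fun u w h1 h2 => language_of_infix h2 h1) hpY ?_ hs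
      intro a ha
      obtain ⟨k, -, rfl⟩ := List.mem_map.1 ha
      exact hlt z hz _
    exact (hY.2.2 Z hZ hZY).resolve_left hne.ne_empty
  · rintro rfl
    refine ⟨hY.1, hY.2.1, subset_levelShift hp hpY hY, fun h => ?_⟩
    have := hN _ (h levelPoint_mem) 0
    simp [levelPoint] at this

theorem isQuasiminimal_levelShift (hp : IsNested N p) (hpY : ∀ k, p k ∈ language Y)
    (hY : IsMinimalSubshift Y) (hN : ∀ y ∈ Y, ∀ i, y i < N) :
    IsQuasiminimal (levelShift N p T) := by
  refine ⟨isSubshift_levelShift hp, (Set.toFinite {∅, Y}).subset ?_⟩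
  rintro Z ⟨h1, h2⟩
  rcases Z.eq_empty_or_nonempty with h | h
  · exact Or.inl h
  · exact Or.inr ((subshift_levelShift_iff hp hpY hY hN Z).1 ⟨h1, h, h2⟩)

/-- This makes the language decidable: only one level, computed from the length of `u`, has to be
inspected. -/
theorem mem_language_levelShift_iff (hp : IsNested N p) (hpY : ∀ k, p k ∈ language Y)
    (hY : IsMinimalSubshift Y) (u : List ℕ) : u ∈ language (levelShift N p T) ↔
      u ∈ language Y ∨ u <:+: level N p T (Nat.pair u.length u.length + 1) := by
  constructor
  · intro h
    rw [language_levelShift] at h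
    obtain ⟨s, hs⟩ := h
    exact (infix_level_bound hp hs).imp_left fun ⟨k, hk⟩ => language_of_infix (hpY k) hk
  · rintro (h | h)
    · exact language_mono (subset_levelShift hp hpY hY) h
    · rw [language_levelShift]
      exact ⟨_, h⟩

/-- The signals `true` for `n` occur in the language precisely when `T` sends `n`. -/
theorem exists_signal_mem_language (hp : IsNested N p) (n : ℕ) :
    (∃ v, (∀ a ∈ v, a < N) ∧
      signal N (p n) (level N p T n) v true ∈ language (levelShift N p T)) ↔
      ∃ s, s.unpair.1 = n ∧ T s = true := by
  rw [language_levelShift]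
  constructor
  · rintro ⟨v, hv, s, hs⟩
    exact exists_of_signal_infix hp hv hs
  · rintro ⟨s, rfl, hs⟩
    refine ⟨p s, hp.lt s, s + 1, ?_⟩
    rw [← hs]
    exact signal_infix_level s

end

/-! ### Computability of the construction -/

section

variable {α β : Type} [Primcodable α] [Primcodable β]

theorem _root_.ComputablePred.comp {p : β → Prop} (hp : ComputablePred p) {f : α → β}
    (hf : Computable f) : ComputablePred fun a => p (f a) := by
  obtain ⟨_, h⟩ := hp
  exact ⟨inferInstance, h.comp hf⟩

theorem _root_.ComputablePred.and {p q : α → Prop} (hp : ComputablePred p)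
    (hq : ComputablePred q) : ComputablePred fun a => p a ∧ q a := by
  classical
  exact Computable.computablePred
    ((Primrec.and.to_comp.comp hp.decide hq.decide).of_eq fun a => by simp)

theorem _root_.ComputablePred.or {p q : α → Prop} (hp : ComputablePred p)
    (hq : ComputablePred q) : ComputablePred fun a => p a ∨ q a := by
  classical
  exact Computable.computablePred
    ((Primrec.or.to_comp.comp hp.decide hq.decide).of_eq fun a => by simp)

/-- The projection of a computable predicate is recursively enumerable. -/
theorem _root_.ComputablePred.exists_re {p : α × β → Prop} (hp : ComputablePred p) :
    REPred fun a => ∃ b, p (a, b) := by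
  classical
  let f : α → ℕ → Option Unit := fun a n =>
    (Encodable.decode n : Option β).bind fun b => bif decide (p (a, b)) then some () else none
  have hf : Computable₂ f := by
    refine Computable.option_bind (Computable.decode.comp Computable.snd) ?_
    exact Computable.cond (hp.decide.comp (Computable.pair (Computable.fst.comp Computable.fst)
      Computable.snd)) (Computable.const _) (Computable.const _)
  refine (Partrec.dom_re (Partrec.rfindOpt hf)).of_eq fun a => ?_
  rw [Nat.rfindOpt_dom]
  constructor
  · rintro ⟨n, u, hu⟩
    obtain ⟨b, -, hb⟩ := Option.bind_eq_some_iff.1 hu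
    refine ⟨b, ?_⟩
    by_contra h
    simp [h] at hb
  · rintro ⟨b, hb⟩
    exact ⟨Encodable.encode b, (), by simp [f, hb]⟩

theorem primrecPred_exists_lt {R : ℕ → α → Prop} (hR : PrimrecRel R) {n : α → ℕ}
    (hn : Primrec n) : PrimrecPred fun a => ∃ k < n a, R k a :=
  (hR.exists_mem_list.comp (Primrec.list_range.comp hn) Primrec.id).of_eq fun a => by simp

theorem primrecPred_forall_lt {R : ℕ → α → Prop} (hR : PrimrecRel R) {n : α → ℕ}
    (hn : Primrec n) : PrimrecPred fun a => ∀ k < n a, R k a :=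
  (hR.forall_mem_list.comp (Primrec.list_range.comp hn) Primrec.id).of_eq fun a => by simp

theorem primrecRel_eq_nat : PrimrecRel fun a b : ℕ => a = b := Primrec.eq

theorem primrecRel_mem : PrimrecRel fun (l : List ℕ) (a : ℕ) => a ∈ l :=
  (PrimrecRel.exists_mem_list primrecRel_eq_nat).of_eq fun l a => by simp

end

/-- The word `v` occurs in `w` at position `k`. -/
theorem primrecPred_prefix_drop {α : Type} [Primcodable α] {v w : α → List ℕ} {k : α → ℕ}
    (hv : Primrec v) (hw : Primrec w) (hk : Primrec k) :
    PrimrecPred fun a => v a <+: (w a).drop (k a) := by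
  refine (PrimrecRel.comp Primrec.eq (Primrec.list_take.comp (Primrec.list_length.comp hv)
    (Primrec.list_drop.comp hk hw)) hv).of_eq fun a => ?_
  rw [List.prefix_iff_eq_take, eq_comm]

theorem infix_iff_exists_prefix_drop (u w : List ℕ) :
    u <:+: w ↔ ∃ k < w.length + 1, u <+: w.drop k := by
  constructor
  · rintro ⟨s, t, rfl⟩
    exact ⟨s.length, by simp, by simp⟩
  · rintro ⟨k, -, h⟩
    exact h.isInfix.trans (List.drop_suffix _ _).isInfix

theorem primrecPred_infix : PrimrecPred fun q : List ℕ × List ℕ => q.1 <:+: q.2 := by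
  have h : PrimrecRel fun (k : ℕ) (q : List ℕ × List ℕ) => q.1 <+: q.2.drop k :=
    primrecPred_prefix_drop (α := ℕ × (List ℕ × List ℕ)) (Primrec.fst.comp Primrec.snd)
      (Primrec.snd.comp Primrec.snd) Primrec.fst
  exact (primrecPred_exists_lt h
    (Primrec.succ.comp (Primrec.list_length.comp Primrec.snd))).of_eq fun q => (infix_iff_exists_prefix_drop _ _).symm

section

variable {α : Type} [Primcodable α]

theorem computable_signal {N : ℕ} {u v q : α → List ℕ} {b : α → Bool} (hu : Computable u)
    (hv : Computable v) (hq : Computable q) (hb : Computable b) :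
    Computable fun a => signal N (u a) (v a) (q a) (b a) := by
  have c : ∀ m : ℕ, Computable fun _ : α => m := fun m => Computable.const m
  exact Computable.list_cons.comp (c _) (Computable.list_append.comp hu (Computable.list_cons.comp
    (c _) (Computable.list_append.comp hv (Computable.list_cons.comp (c _)
      (Computable.list_append.comp hq (Computable.list_cons.comp (Computable.cond hb (c _) (c _))
        (Computable.const [])))))))

theorem computable_separated {N : ℕ} {q w : α → List ℕ} (hq : Computable q) (hw : Computable w) :
    Computable fun a => separated N (q a) (w a) := by
  have c : ∀ m : ℕ, Computable fun _ : α => m := fun m => Computable.const m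
  exact Computable.list_append.comp hw (Computable.list_cons.comp (c _) (Computable.list_append.comp
    hq (Computable.list_cons.comp (c _) (Computable.list_append.comp hw (Computable.list_cons.comp
      (c _) (Computable.list_append.comp hq (Computable.list_cons.comp (c _) hw)))))))

end

/-- Course-of-values recursion: `W_{s+1}` uses both `W_s` and the earlier `W_a`, so the list of all
previous levels is fed to the step. -/
theorem computable_level {N : ℕ} {p : ℕ → List ℕ} {T : ℕ → Bool} (hp : Computable p)
    (hT : Computable T) : Computable (level N p T) := by
  let F : ℕ → List ℕ → List ℕ → List ℕ := fun s W A =>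
    W ++ N :: (W ++ (signal N (p s.unpair.1) A (p s) (T s) ++ separated N (p s) W))
  let g : Unit → List (List ℕ) → Option (List ℕ) := fun _ l =>
    Nat.casesOn (motive := fun _ => Option (List ℕ)) l.length (some [N]) fun s =>
      l[s]?.bind fun W => l[s.unpair.1]?.map fun A => F s W A
  have hF : Computable fun q : ((((Unit × List (List ℕ)) × ℕ) × List ℕ) × List ℕ) =>
      F q.1.1.2 q.1.2 q.2 := by
    have hs : Computable fun q : ((((Unit × List (List ℕ)) × ℕ) × List ℕ) × List ℕ) => q.1.1.2 :=
      Computable.snd.comp (Computable.fst.comp Computable.fst)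
    have hW : Computable fun q : ((((Unit × List (List ℕ)) × ℕ) × List ℕ) × List ℕ) => q.1.2 :=
      Computable.snd.comp Computable.fst
    exact Computable.list_append.comp hW (Computable.list_cons.comp (Computable.const N)
      (Computable.list_append.comp hW (Computable.list_append.comp
        (computable_signal (hp.comp (Computable.fst.comp (Computable.unpair.comp hs)))
          Computable.snd (hp.comp hs) (hT.comp hs)) (computable_separated (hp.comp hs) hW))))
  have hg : Computable₂ g := by
    refine Computable.nat_casesOn (Computable.list_length.comp Computable.snd)
      (Computable.const _) ?_
    refine Computable.option_bind (Computable.list_getElem?.comp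
      (Computable.snd.comp Computable.fst) Computable.snd) ?_
    refine Computable.option_map (Computable.list_getElem?.comp
      (Computable.snd.comp (Computable.fst.comp Computable.fst))
      (Computable.fst.comp (Computable.unpair.comp (Computable.snd.comp Computable.fst)))) ?_
    exact hF
  have := Computable.nat_strong_rec (fun (_ : Unit) n => level N p T n) hg fun _ n => by
    cases n with
    | zero => simp [g, level_zero]
    | succ s =>
      have h1 : s.unpair.1 < s + 1 := Nat.lt_succ_of_le (Nat.unpair_left_le s)
      simp [g, F, level_succ, List.getElem?_range h1]
  exact this.comp (Computable.const ()) Computable.id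

theorem isRecursive_levelShift {N : ℕ} {p : ℕ → List ℕ} {T : ℕ → Bool} {Y : Set (ℤ → ℕ)}
    (hp : IsNested N p) (hpY : ∀ k, p k ∈ language Y) (hY : IsMinimalSubshift Y)
    (hr : IsRecursive Y) (hpc : Computable p) (hT : Computable T) :
    IsRecursive (levelShift N p T) := by
  have hl : Computable fun u : List ℕ => level N p T (Nat.pair u.length u.length + 1) :=
    (computable_level hpc hT).comp (Computable.succ.comp (Primrec₂.natPair.to_comp.comp
      Computable.list_length Computable.list_length))
  exact (hr.or (primrecPred_infix.computablePred.comp (Computable.id.pair hl))).of_eq fun u =>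
    (mem_language_levelShift_iff hp hpY hY u).symm

/-- The encoding of `ℤ` sends `n` to `2 * n` and `-(n + 1)` to `2 * n + 1`, so the sign is a parity.
-/
theorem primrec_int_toNat : Primrec Int.toNat := by
  have h : Primrec fun n : ℕ => bif n.bodd then 0 else n.div2 :=
    Primrec.cond Primrec.nat_bodd (Primrec.const 0) Primrec.nat_div2
  refine (h.comp (Primrec.encode (α := ℤ))).of_eq fun z => ?_
  cases z with
  | ofNat n =>
    change (bif (2 * n).bodd then 0 else (2 * n).div2) = n
    simp
  | negSucc n =>
    change (bif (2 * n + 1).bodd then 0 else (2 * n + 1).div2) = 0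
    simp

theorem primrec_int_neg_toNat : Primrec fun z : ℤ => (-z).toNat := by
  have h : Primrec fun n : ℕ => bif n.bodd then n.div2 + 1 else 0 :=
    Primrec.cond Primrec.nat_bodd (Primrec.succ.comp Primrec.nat_div2) (Primrec.const 0)
  refine (h.comp (Primrec.encode (α := ℤ))).of_eq fun z => ?_
  cases z with
  | ofNat n =>
    change (bif (2 * n).bodd then (2 * n).div2 + 1 else 0) = (-(n : ℤ)).toNat
    simp
  | negSucc n =>
    change (bif (2 * n + 1).bodd then (2 * n + 1).div2 + 1 else 0) = n + 1
    simp [Nat.div2_val]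

theorem primrec_int_natCast : Primrec fun n : ℕ => (n : ℤ) :=
  Primrec.encode_iff.1 (Primrec.nat_double.of_eq fun _ => rfl)

/-! ### The halting problem along a clopen set is recursively enumerable -/

/-- A word of `c` occurs in `w` when the origin is at position `a` of `w`. -/
def ClopenCode.OccursIn (c : ClopenCode) (w : List ℕ) (a : ℕ) : Prop :=
  ∃ v ∈ c.2, 0 ≤ c.1 + a ∧ v <+: w.drop (c.1 + a).toNat

theorem ClopenCode.primrecPred_occursIn :
    PrimrecPred fun q : ClopenCode × List ℕ × ℕ => q.1.OccursIn q.2.1 q.2.2 := by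
  have h1 : Primrec fun q : List ℕ × ClopenCode × List ℕ × ℕ => q.2.1.1 :=
    Primrec.fst.comp (Primrec.fst.comp Primrec.snd)
  have h2 : Primrec fun q : List ℕ × ClopenCode × List ℕ × ℕ => q.2.2.2 :=
    Primrec.snd.comp (Primrec.snd.comp Primrec.snd)
  have h3 : Primrec fun q : List ℕ × ClopenCode × List ℕ × ℕ => q.2.2.1 :=
    Primrec.fst.comp (Primrec.snd.comp Primrec.snd)
  have h4 := Primrec.nat_add.comp (primrec_int_toNat.comp h1) h2
  have h5 := primrec_int_neg_toNat.comp h1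
  -- The integer position `c.1 + a` is replaced by natural arithmetic on the positive and negative
  -- parts of `c.1`.
  have h6 : PrimrecRel fun (v : List ℕ) (q : ClopenCode × List ℕ × ℕ) =>
      (-q.1.1).toNat ≤ q.1.1.toNat + q.2.2 ∧
        v <+: q.2.1.drop (q.1.1.toNat + q.2.2 - (-q.1.1).toNat) :=
    PrimrecPred.and (PrimrecRel.comp Primrec.nat_le h5 h4)
      (primrecPred_prefix_drop Primrec.fst h3 (Primrec.nat_sub.comp h4 h5))
  refine (h6.exists_mem_list.comp (Primrec.snd.comp Primrec.fst) Primrec.id).of_eq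
    fun q => exists_congr fun v => and_congr_right fun _ => ?_
  have e : (id q : ClopenCode × List ℕ × ℕ) = q := rfl
  rw [e, show q.1.1.toNat + q.2.2 - (-q.1.1).toNat = (q.1.1 + q.2.2).toNat by omega]
  exact and_congr_left fun _ => by omega

theorem occursAt_of_prefix_drop {x : ℤ → ℕ} {i : ℤ} {n k : ℕ} {v : List ℕ}
    (h : v <+: (word x i n).drop k) : OccursAt v x (i + k) := by
  intro l hl
  obtain ⟨t, ht⟩ := h
  have hlen : k + l < (word x i n).length := by
    have := congrArg List.length ht
    simp at this ⊢
    omega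
  have h1 : (word x i n)[k + l] = v[l] := by
    rw [← List.getElem_drop (h := by rw [List.length_drop]; omega)]
    simp [← ht, hl]
  rw [← h1, getElem_word, Nat.cast_add, add_assoc]

theorem prefix_drop_of_occursAt {x : ℤ → ℕ} {i : ℤ} {n k : ℕ} {v : List ℕ}
    (h : OccursAt v x (i + k)) (hn : k + v.length ≤ n) : v <+: (word x i n).drop k := by
  obtain ⟨m, rfl⟩ := Nat.exists_eq_add_of_le hn
  rw [word_add, word_add, occursAt_iff.1 h, List.append_assoc]
  exact ⟨_, by simp; rfl⟩

theorem ClopenCode.mem_toSet_of_occursIn {c : ClopenCode} {x : ℤ → ℕ} {i : ℤ} {n a : ℕ}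
    (h : c.OccursIn (word x i n) a) : (fun k => x (k + (i + a))) ∈ c.toSet := by
  obtain ⟨v, hv, h1, h2⟩ := h
  refine ⟨v, hv, occursAt_translate.2 ?_⟩
  have := occursAt_of_prefix_drop h2
  rwa [Int.toNat_of_nonneg h1, show i + (c.1 + a) = c.1 + (i + a) by ring] at this

theorem ClopenCode.occursIn_of_mem_toSet {c : ClopenCode} {x : ℤ → ℕ} {j n a m : ℕ}
    (hm : ∀ v ∈ c.2, v.length ≤ m) (ha : c.1.natAbs ≤ a) (hn : c.1.natAbs + a + j + m ≤ n)
    (h : shift^[j] x ∈ c.toSet) : c.OccursIn (word x (-a) n) (a + j) := by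
  obtain ⟨v, hv, h1⟩ := h
  have h0 : 0 ≤ c.1 + (a + j : ℕ) := by omega
  refine ⟨v, hv, h0, prefix_drop_of_occursAt ?_ ?_⟩
  · rw [Int.toNat_of_nonneg h0, show -(a : ℤ) + (c.1 + (a + j : ℕ)) = c.1 + j by push_cast; ring]
    exact occursAt_shift_iterate.1 h1
  · have := hm v hv
    omega

theorem exists_length_bound (L : List (List ℕ)) : ∃ m, ∀ v ∈ L, v.length ≤ m := by
  induction L with
  | nil => exact ⟨0, by simp⟩
  | cons u L ih =>
    obtain ⟨m, hm⟩ := ih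
    refine ⟨u.length + m, fun v hv => ?_⟩
    rcases List.mem_cons.1 hv with rfl | hv
    · omega
    · have := hm v hv; omega

/-- A finite run depends on finitely many coordinates, so a word of the language, an index for the
origin and a number of steps are a complete witness. -/
theorem haltingAlongClopen_iff {X : Set (ℤ → ℕ)} (hX : IsSubshift X)
    (c : ClopenCode × ClopenCode × ClopenCode) : HaltingAlongClopen X c ↔
      ∃ b : List ℕ × ℕ × ℕ, b.1 ∈ language X ∧ c.1.OccursIn b.1 b.2.1 ∧
        c.2.1.OccursIn b.1 (b.2.1 + b.2.2) ∧
          ∀ i < b.2.2, 1 ≤ i → c.2.2.OccursIn b.1 (b.2.1 + i) := by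
  obtain ⟨C, D, E⟩ := c
  constructor
  · rintro ⟨x, hx, j, h1, h2, h3⟩
    obtain ⟨m1, hm1⟩ := exists_length_bound C.2
    obtain ⟨m2, hm2⟩ := exists_length_bound D.2
    obtain ⟨m3, hm3⟩ := exists_length_bound E.2
    -- Placing the origin at index `a` keeps all three positions inside the window; `n` leaves room
    -- for `j` steps and for the longest word listed.
    let a := C.1.natAbs + D.1.natAbs + E.1.natAbs
    let n := a + a + j + (m1 + m2 + m3)
    refine ⟨(word x (-a) n, a, j), word_mem_language hx _ _, ?_, ?_, fun i hi hi1 => ?_⟩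
    · exact ClopenCode.occursIn_of_mem_toSet (j := 0) hm1 (by simp only; omega)
        (by simp only; omega) h1
    · exact ClopenCode.occursIn_of_mem_toSet hm2 (by simp only; omega) (by simp only; omega) h2
    · simp only at hi
      exact ClopenCode.occursIn_of_mem_toSet hm3 (by simp only; omega) (by simp only; omega)
        (h3 i hi1 hi)
  · rintro ⟨⟨w, a, j⟩, hw, h1, h2, h3⟩
    obtain ⟨x, hx, i, hi⟩ := mem_language.1 hw
    simp only at h1 h2 h3 hi
    have key : ∀ (F : ClopenCode) (k : ℕ), F.OccursIn w (a + k) →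
        shift^[k] (fun l => x (l + (i + a))) ∈ F.toSet := by
      intro F k hF
      rw [← hi] at hF
      have := ClopenCode.mem_toSet_of_occursIn hF
      convert this using 1
      funext l
      rw [shift_iterate]
      push_cast
      ring_nf
    exact ⟨_, hX.translate_mem hx (i + a), j, key C 0 h1, key D j h2,
      fun k hk1 hk => key E k (h3 k hk hk1)⟩

/-- An instance of the halting problem along a clopen set, a word, a position of the origin in the
word, and a number of steps. -/
abbrev HaltingWitness : Type := (ClopenCode × ClopenCode × ClopenCode) × List ℕ × ℕ × ℕ

theorem haltingAlongClopen_re {X : Set (ℤ → ℕ)} (hX : IsSubshift X) (hr : IsRecursive X) :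
    REPred (HaltingAlongClopen X) := by
  have hw : Primrec fun q : HaltingWitness => q.2.1 := Primrec.fst.comp Primrec.snd
  have ha : Primrec fun q : HaltingWitness => q.2.2.1 :=
    Primrec.fst.comp (Primrec.snd.comp Primrec.snd)
  have hj : Primrec fun q : HaltingWitness => q.2.2.2 :=
    Primrec.snd.comp (Primrec.snd.comp Primrec.snd)
  have h1 : PrimrecPred fun q : HaltingWitness => q.1.1.OccursIn q.2.1 q.2.2.1 :=
    ClopenCode.primrecPred_occursIn.comp ((Primrec.fst.comp Primrec.fst).pair (hw.pair ha))
  have h2 : PrimrecPred fun q : HaltingWitness =>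
      q.1.2.1.OccursIn q.2.1 (q.2.2.1 + q.2.2.2) :=
    ClopenCode.primrecPred_occursIn.comp ((Primrec.fst.comp (Primrec.snd.comp Primrec.fst)).pair
      (hw.pair (Primrec.nat_add.comp ha hj)))
  have h3 : PrimrecRel fun (i : ℕ) (q : HaltingWitness) =>
      1 ≤ i → q.1.2.2.OccursIn q.2.1 (q.2.2.1 + i) := by
    have h4 : PrimrecPred fun r : ℕ × HaltingWitness =>
        r.2.1.2.2.OccursIn r.2.2.1 (r.2.2.2.1 + r.1) :=
      ClopenCode.primrecPred_occursIn.comp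
        ((Primrec.snd.comp (Primrec.snd.comp (Primrec.fst.comp Primrec.snd))).pair
          ((hw.comp Primrec.snd).pair (Primrec.nat_add.comp (ha.comp Primrec.snd) Primrec.fst)))
    have h5 : PrimrecPred fun r : ℕ × HaltingWitness => 1 ≤ r.1 :=
      PrimrecRel.comp Primrec.nat_le (Primrec.const 1) Primrec.fst
    exact (h5.not.or h4).of_eq fun r => imp_iff_not_or.symm
  have h6 : ComputablePred fun q : HaltingWitness =>
      q.2.1 ∈ language X ∧ q.1.1.OccursIn q.2.1 q.2.2.1 ∧
        q.1.2.1.OccursIn q.2.1 (q.2.2.1 + q.2.2.2) ∧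
          ∀ i < q.2.2.2, 1 ≤ i → q.1.2.2.OccursIn q.2.1 (q.2.2.1 + i) :=
    (ComputablePred.comp hr hw.to_comp).and
      (h1.and (h2.and (primrecPred_forall_lt h3 hj))).computablePred
  exact h6.exists_re.of_eq fun c => (haltingAlongClopen_iff hX c).symm

/-! ### Model checking is recursively enumerable -/

/-- The states of `M` reachable by reading `w`. -/
def AutomatonCode.run (M : AutomatonCode) (w : List ℕ) : List ℕ :=
  w.foldl (fun S a => (M.1.filter fun t => t.1 ∈ S ∧ t.2.1 = a).map fun t => t.2.2) M.2.1

theorem AutomatonCode.mem_run (M : AutomatonCode) (w : List ℕ) (q : ℕ) :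
    q ∈ M.run w ↔ q ∈ M.toNFA.eval w := by
  induction w using List.reverseRecOn generalizing q with
  | nil => rfl
  | append_singleton w a ih =>
    rw [NFA.eval_append_singleton, NFA.mem_stepSet, run, List.foldl_append]
    simp only [List.foldl_cons, List.foldl_nil]
    rw [← run]
    constructor
    · intro h
      obtain ⟨⟨s, b, r⟩, h1, rfl⟩ := List.mem_map.1 h
      simp only [List.mem_filter, decide_eq_true_eq] at h1
      obtain ⟨h1, h2, rfl⟩ := h1
      exact ⟨s, (ih s).1 h2, h1⟩
    · rintro ⟨s, h1, h2⟩
      exact List.mem_map.2 ⟨(s, a, q), List.mem_filter.2 ⟨h2, by simp [(ih s).2 h1]⟩, rfl⟩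

theorem AutomatonCode.primrec_run :
    Primrec fun q : AutomatonCode × List ℕ => q.1.run q.2 := by
  have h1 : PrimrecRel fun (t : ℕ × ℕ × ℕ) (b : List ℕ × ℕ) => t.1 ∈ b.1 ∧ t.2.1 = b.2 :=
    PrimrecPred.and
      (primrecRel_mem.comp (Primrec.fst.comp Primrec.snd) (Primrec.fst.comp Primrec.fst))
      (primrecRel_eq_nat.comp (Primrec.fst.comp (Primrec.snd.comp Primrec.fst))
        (Primrec.snd.comp Primrec.snd))
  have h2 : Primrec₂ fun (q : AutomatonCode × List ℕ) (b : List ℕ × ℕ) =>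
      (q.1.1.filter fun t => t.1 ∈ b.1 ∧ t.2.1 = b.2).map fun t => t.2.2 :=
    Primrec.list_map (h1.listFilter.comp (Primrec.fst.comp (Primrec.fst.comp Primrec.fst))
      Primrec.snd) (Primrec.snd.comp (Primrec.snd.comp Primrec.snd))
  exact Primrec.list_foldl Primrec.snd (Primrec.fst.comp (Primrec.snd.comp Primrec.fst)) h2

theorem modelChecking_re {X : Set (ℤ → ℕ)} (hr : IsRecursive X) : REPred (ModelChecking X) := by
  have h1 : PrimrecRel fun (q : ℕ) (a : AutomatonCode × List ℕ) => q ∈ a.1.run a.2 :=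
    primrecRel_mem.comp (AutomatonCode.primrec_run.comp Primrec.snd) Primrec.fst
  have h2 : PrimrecPred fun a : AutomatonCode × List ℕ => ∃ q ∈ a.1.2.2, q ∈ a.1.run a.2 :=
    h1.exists_mem_list.comp (Primrec.snd.comp (Primrec.snd.comp Primrec.fst)) Primrec.id
  have h3 : ComputablePred fun a : AutomatonCode × List ℕ => a.2 ∈ language X :=
    ComputablePred.comp hr Computable.snd
  refine (h3.and h2.computablePred).exists_re.of_eq fun M => exists_congr fun w =>
    and_congr_right fun _ => exists_congr fun q => and_congr_right fun _ => M.mem_run w q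

/-! ### Instances that search across a marker-free gap -/

/-- An automaton for the words `u ++ v ++ [m]` where `v` is a word over the letters below `N`. -/
def gapAutomaton (N m : ℕ) (u : List ℕ) : AutomatonCode :=
  ((List.range u.length).map (fun i => (i, u.getD i 0, i + 1)) ++
    ((List.range N).map (fun a => (u.length, a, u.length)) ++ [(u.length, m, u.length + 1)]),
    [0], [u.length + 1])

theorem primrec_gapAutomaton (N m : ℕ) : Primrec (gapAutomaton N m) := by
  have hl : Primrec fun u : List ℕ => u.length := Primrec.list_length
  have h1 : Primrec fun u : List ℕ => (List.range u.length).map fun i => (i, u.getD i 0, i + 1) :=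
    Primrec.list_map (Primrec.list_range.comp hl) (Primrec.snd.pair
      (((Primrec.list_getD 0).comp Primrec.fst Primrec.snd).pair (Primrec.succ.comp Primrec.snd)))
  have h2 : Primrec fun u : List ℕ => (List.range N).map fun a => (u.length, a, u.length) :=
    Primrec.list_map (Primrec.const _) ((hl.comp Primrec.fst).pair
      (Primrec.snd.pair (hl.comp Primrec.fst)))
  have h3 : Primrec fun u : List ℕ => [(u.length, m, u.length + 1)] :=
    Primrec.list_cons.comp (hl.pair ((Primrec.const m).pair (Primrec.succ.comp hl)))
      (Primrec.const [])
  exact (Primrec.list_append.comp h1 (Primrec.list_append.comp h2 h3)).pair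
    ((Primrec.const [0]).pair (Primrec.list_cons.comp (Primrec.succ.comp hl) (Primrec.const [])))

theorem mem_step_gapAutomaton {N m : ℕ} {u : List ℕ} {s a r : ℕ} :
    r ∈ (gapAutomaton N m u).toNFA.step s a ↔ (s < u.length ∧ u.getD s 0 = a ∧ r = s + 1) ∨
      (s = u.length ∧ a < N ∧ r = u.length) ∨ (s = u.length ∧ a = m ∧ r = u.length + 1) := by
  have : r ∈ (gapAutomaton N m u).toNFA.step s a ↔ (s, a, r) ∈ (gapAutomaton N m u).1 := Iff.rfl
  rw [this]
  simp only [gapAutomaton, List.mem_append, List.mem_map, List.mem_range, Prod.mk.injEq,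
    List.mem_singleton]
  grind

theorem mem_accepts_gapAutomaton {N m : ℕ} {u w : List ℕ} :
    w ∈ (gapAutomaton N m u).toNFA.accepts ↔ ∃ v, (∀ a ∈ v, a < N) ∧ w = u ++ (v ++ [m]) := by
  set M := (gapAutomaton N m u).toNFA with hM
  have hacc : w ∈ M.accepts ↔ u.length + 1 ∈ M.eval w := by
    constructor
    · rintro ⟨s, h1, h2⟩
      have h3 : s ∈ [u.length + 1] := h1
      rwa [List.mem_singleton.1 h3] at h2
    · intro h
      have : u.length + 1 ∈ [u.length + 1] := by simp
      exact ⟨_, this, h⟩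
  have hstart : ∀ s, s ∈ M.start ↔ s = 0 := fun s => by
    have : s ∈ M.start ↔ s ∈ [0] := Iff.rfl
    simp [this]
  rw [hacc]
  clear hacc
  constructor
  -- State `s < u.length` records that `s` letters of `u` have been read; state `u.length` loops
  -- over the gap; the last state is reached by the closing `m` and has no exit.
  · have key : ∀ w s, s ∈ M.eval w → (s < u.length ∧ w = u.take s) ∨
        (s = u.length ∧ ∃ v, (∀ a ∈ v, a < N) ∧ w = u ++ v) ∨
        (s = u.length + 1 ∧ ∃ v, (∀ a ∈ v, a < N) ∧ w = u ++ (v ++ [m])) := by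
      intro w
      induction w using List.reverseRecOn with
      | nil =>
        intro s hs
        rw [NFA.eval_nil, hstart] at hs
        subst hs
        rcases Nat.eq_zero_or_pos u.length with h | h
        · exact Or.inr (Or.inl ⟨h.symm, [], by simp, by simp [List.length_eq_zero_iff.1 h]⟩)
        · exact Or.inl ⟨h, by simp⟩
      | append_singleton w a ih =>
        intro s hs
        rw [NFA.eval_append_singleton, NFA.mem_stepSet] at hs
        obtain ⟨r, hr, hs⟩ := hs
        rcases mem_step_gapAutomaton.1 hs with ⟨h1, h2, rfl⟩ | ⟨rfl, h2, rfl⟩ | ⟨rfl, rfl, rfl⟩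
        · rcases ih r hr with ⟨-, rfl⟩ | ⟨rfl, -⟩ | ⟨rfl, -⟩
          · have h3 : u.take r ++ [a] = u.take (r + 1) := by
              rw [← h2, List.getD_eq_getElem _ _ h1, List.take_concat_get']
            rcases (Nat.succ_le_of_lt h1).lt_or_eq with h | h
            · exact Or.inl ⟨h, h3⟩
            · refine Or.inr (Or.inl ⟨h, [], by simp, ?_⟩)
              rw [h3, List.append_nil]
              exact List.take_of_length_le (le_of_eq h.symm)
          · omega
          · omega
        · rcases ih _ hr with ⟨h, -⟩ | ⟨-, v, hv, rfl⟩ | ⟨h, -⟩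
          · omega
          · refine Or.inr (Or.inl ⟨rfl, v ++ [a], ?_, by simp⟩)
            intro b hb
            rcases List.mem_append.1 hb with hb | hb
            · exact hv b hb
            · rwa [List.mem_singleton.1 hb]
          · omega
        · rcases ih _ hr with ⟨h, -⟩ | ⟨-, v, hv, rfl⟩ | ⟨h, -⟩
          · omega
          · exact Or.inr (Or.inr ⟨rfl, v, hv, by simp⟩)
          · omega
    intro h
    rcases key w _ h with ⟨h, -⟩ | ⟨h, -⟩ | ⟨-, h⟩
    · omega
    · omega
    · exact h
  · rintro ⟨v, hv, rfl⟩
    have h1 : ∀ i ≤ u.length, i ∈ M.eval (u.take i) := by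
      intro i hi
      induction i with
      | zero => simp [hstart]
      | succ i ih =>
        rw [← List.take_concat_get' u i hi, NFA.eval_append_singleton, NFA.mem_stepSet]
        refine ⟨i, ih (by omega), mem_step_gapAutomaton.2 (Or.inl ⟨hi, ?_, rfl⟩)⟩
        exact List.getD_eq_getElem _ _ hi
    have h2 : u.length ∈ M.eval (u ++ v) := by
      induction v using List.reverseRecOn with
      | nil => simpa using h1 _ le_rfl
      | append_singleton v a ih =>
        rw [← List.append_assoc, NFA.eval_append_singleton, NFA.mem_stepSet]
        exact ⟨_, ih fun b hb => hv b (by simp [hb]),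
          mem_step_gapAutomaton.2 (Or.inr (Or.inl ⟨rfl, hv a (by simp), rfl⟩))⟩
    rw [← List.append_assoc, NFA.eval_append_singleton, NFA.mem_stepSet]
    exact ⟨_, h2, mem_step_gapAutomaton.2 (Or.inr (Or.inr ⟨rfl, rfl, rfl⟩))⟩

theorem modelChecking_gapAutomaton {X : Set (ℤ → ℕ)} {N m : ℕ} {u : List ℕ} :
    ModelChecking X (gapAutomaton N m u) ↔
      ∃ v, (∀ a ∈ v, a < N) ∧ u ++ (v ++ [m]) ∈ language X := by
  constructor
  · rintro ⟨w, hw, h⟩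
    obtain ⟨v, hv, rfl⟩ := mem_accepts_gapAutomaton.1 h
    exact ⟨v, hv, hw⟩
  · rintro ⟨v, hv, h⟩
    exact ⟨_, h, mem_accepts_gapAutomaton.2 ⟨v, hv, rfl⟩⟩

/-- An instance of the halting problem asking for a word `u ++ [b] ++ v ++ [m]` where `v` is a word
over the letters below `N`. -/
def gapInstance (N m b : ℕ) (u : List ℕ) : ClopenCode × ClopenCode × ClopenCode :=
  ((0, [u ++ [b]]), (u.length, [[m]]), (u.length, (List.range N).map fun a => [a]))

theorem primrec_gapInstance (N m b : ℕ) : Primrec (gapInstance N m b) := by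
  have hl : Primrec fun u : List ℕ => (u.length : ℤ) :=
    primrec_int_natCast.comp Primrec.list_length
  exact ((Primrec.const (0 : ℤ)).pair (Primrec.list_cons.comp
    (Primrec.list_append.comp Primrec.id (Primrec.const [b])) (Primrec.const []))).pair
      ((hl.pair (Primrec.const [[m]])).pair
        (hl.pair (Primrec.const ((List.range N).map fun a => [a]))))

theorem occursAt_singleton {a : ℕ} {x : ℤ → ℕ} {i : ℤ} : OccursAt [a] x i ↔ x i = a := by
  simp [OccursAt]

/-- The orbit moves a reading head from the letter `b` to the letter `m`; the clopen set `E` forces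
every letter passed in between to be below `N`. -/
theorem haltingAlongClopen_gapInstance {X : Set (ℤ → ℕ)} (hX : IsSubshift X) {N m b : ℕ}
    (hb : b ≠ m) {u : List ℕ} : HaltingAlongClopen X (gapInstance N m b u) ↔
      ∃ v, (∀ a ∈ v, a < N) ∧ (u ++ [b]) ++ (v ++ [m]) ∈ language X := by
  have hlen : (u ++ [b]).length = u.length + 1 := by simp
  constructor
  · rintro ⟨x, hx, j, ⟨w, hw, h1⟩, ⟨w', hw', h2⟩, h3⟩
    obtain rfl := List.mem_singleton.1 hw
    obtain rfl := List.mem_singleton.1 hw'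
    simp only [gapInstance] at h1 h2
    rw [occursAt_singleton, shift_iterate] at h2
    have hb' : x u.length = b := by
      have := h1 u.length (by simp)
      simpa using this
    -- With no step at all the head would read both `b` and `m`.
    obtain ⟨j, rfl⟩ : ∃ k, j = k + 1 := by
      refine ⟨j - 1, ?_⟩
      rcases j with _ | j
      · refine absurd ?_ hb
        rw [← hb', ← h2]
        simp
      · simp
    refine ⟨word x (u.length + 1) j, ?_, ?_⟩
    · intro a ha
      obtain ⟨k, hk, rfl⟩ := List.mem_map.1 ha
      rw [List.mem_range] at hk
      obtain ⟨w, hw, h4⟩ := h3 (k + 1) (by omega) (by omega)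
      obtain ⟨a, ha, rfl⟩ := List.mem_map.1 hw
      rw [occursAt_singleton, shift_iterate] at h4
      simp only [gapInstance] at h4
      rw [show (u.length : ℤ) + 1 + k = u.length + (k + 1 : ℕ) by push_cast; ring, h4]
      exact List.mem_range.1 ha
    · have e : (u ++ [b]) ++ (word x (u.length + 1) j ++ [m]) =
          word x 0 ((u ++ [b]).length + (j + 1)) := by
        rw [word_add, word_add, word_one, occursAt_iff.1 h1, hlen, ← h2]
        push_cast
        ring_nf
      rw [e]
      exact word_mem_language hx _ _
  · rintro ⟨v, hv, h⟩
    obtain ⟨x, hx, i, hi⟩ := mem_language.1 h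
    rw [List.length_append, word_add] at hi
    obtain ⟨h1, h2⟩ := List.append_inj hi (by simp)
    rw [List.length_append (as := v), word_add, List.length_singleton, word_one] at h2
    obtain ⟨h2, h3⟩ := List.append_inj h2 (by simp)
    rw [List.singleton_inj, hlen] at h3
    rw [hlen] at h2
    refine ⟨_, hX.translate_mem hx i, v.length + 1, ⟨_, List.mem_singleton_self _, ?_⟩,
      ⟨_, List.mem_singleton_self _, ?_⟩, fun k hk1 hk => ⟨[x (i + u.length + k)], ?_, ?_⟩⟩
    · rw [occursAt_translate, occursAt_iff]
      simpa [gapInstance] using h1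
    · rw [occursAt_singleton, shift_iterate, ← h3]
      simp only [gapInstance]
      push_cast
      ring_nf
    · refine List.mem_map.2 ⟨_, List.mem_range.2 (hv _ ?_), rfl⟩
      rw [← h2]
      refine List.mem_map.2 ⟨k - 1, List.mem_range.2 (by omega), ?_⟩
      congr 1
      push_cast [Nat.cast_sub hk1]
      ring
    · rw [occursAt_singleton, shift_iterate]
      simp only [gapInstance]
      ring_nf

/-! ### Completeness and conclusion -/

/-- The pair `s = (n, t)` is such that program `n.unpair.1` halts on input `n.unpair.2` within
`t` steps. -/
def haltsAt (s : ℕ) : Bool :=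
  (Nat.Partrec.Code.evaln s.unpair.2 (Denumerable.ofNat Nat.Partrec.Code s.unpair.1.unpair.1)
    s.unpair.1.unpair.2).isSome

theorem computable_haltsAt : Computable haltsAt := by
  have h1 : Primrec fun s : ℕ => s.unpair.1 := Primrec.fst.comp Primrec.unpair
  have h2 : Primrec fun s : ℕ => s.unpair.2 := Primrec.snd.comp Primrec.unpair
  exact (Primrec.option_isSome.comp (Nat.Partrec.Code.primrec_evaln.comp
    ((h2.pair ((Primrec.ofNat Nat.Partrec.Code).comp (h1.comp h1))).pair (h2.comp h1)))).to_comp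

theorem exists_haltsAt_iff (n : ℕ) : (∃ s, s.unpair.1 = n ∧ haltsAt s = true) ↔
    (Nat.Partrec.Code.eval (Denumerable.ofNat Nat.Partrec.Code n.unpair.1) n.unpair.2).Dom := by
  rw [Part.dom_iff_mem]
  constructor
  · rintro ⟨s, rfl, hs⟩
    obtain ⟨y, hy⟩ := Option.isSome_iff_exists.1 hs
    exact ⟨y, Nat.Partrec.Code.evaln_sound hy⟩
  · rintro ⟨y, hy⟩
    obtain ⟨k, hk⟩ := Nat.Partrec.Code.evaln_complete.1 hy
    refine ⟨Nat.pair n k, by simp, Option.isSome_iff_exists.2 ⟨y, ?_⟩⟩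
    simpa using hk

/-- An r.e. predicate is the domain of a program `c`, and `n ↦ (c, n)` reduces it to the halting
problem. -/
theorem manyOneReducible_haltsAt {q : ℕ → Prop} (hq : REPred q) :
    ManyOneReducible q fun n => ∃ s, s.unpair.1 = n ∧ haltsAt s = true := by
  have h1 : Nat.Partrec fun n => (Part.assert (q n) fun _ => Part.some ()).map Encodable.encode :=
    Partrec.nat_iff.1 (Partrec.map_encode_iff.2 hq)
  obtain ⟨c, hc⟩ := Nat.Partrec.Code.exists_code.1 h1
  refine ⟨fun n => Nat.pair (Encodable.encode c) n,
    (Primrec₂.natPair.comp (Primrec.const _) Primrec.id).to_comp, fun n => ?_⟩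
  refine Iff.trans ?_ (exists_haltsAt_iff _).symm
  simp only [Nat.unpair_pair, Denumerable.ofNat_encode, hc]
  simp [Part.assert]

theorem isSigma1Complete_of_reducible {α : Type} [Primcodable α] {P : α → Prop} (hP : REPred P)
    (h : ManyOneReducible (fun n => ∃ s, s.unpair.1 = n ∧ haltsAt s = true) P) :
    IsSigma1Complete P :=
  ⟨hP, fun _ hq => (manyOneReducible_haltsAt hq).trans h⟩

/-- The subshift is `levelShift` with `T = haltsAt`. Both reductions send `n` to the fixed beginning
of its signal, leaving the gap before `N + 4` free. `Y` need not be infinite here, so a fixed point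
may serve as `Y`. -/
theorem IsMinimalSubshift.exists_universal {Y : Set (ℤ → ℕ)} (hY : IsMinimalSubshift Y)
    (hr : IsRecursive Y) :
    ∃ X, IsSubshift X ∧ IsTransitive X ∧ Y ⊆ X ∧ IsRecursive X ∧ IsQuasiminimal X ∧
      (∀ Z : Set (ℤ → ℕ), (IsSubshift Z ∧ Z.Nonempty ∧ Z ⊂ X) ↔ Z = Y) ∧
      IsSigma1Complete (HaltingAlongClopen X) ∧ IsUniversal X := by
  obtain ⟨N, hN⟩ := hY.1.exists_bound
  obtain ⟨p, hpc, hp, hpY⟩ := hY.exists_isNested hr hN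
  have hX := isSubshift_levelShift (T := haltsAt) hp
  have hXr := isRecursive_levelShift hp hpY hY hr hpc computable_haltsAt
  let f : ℕ → List ℕ := fun n => (N + 1) :: (p n ++ (N + 2) :: level N p haltsAt n)
  have hf : Computable f :=
    Computable.list_cons.comp (Computable.const _) (Computable.list_append.comp hpc
      (Computable.list_cons.comp (Computable.const _) (computable_level hpc computable_haltsAt)))
  have hsig : ∀ n v, signal N (p n) (level N p haltsAt n) v true =
      (f n ++ [N + 3]) ++ (v ++ [N + 4]) := fun n v => by simp [signal, f]
  have hK := exists_signal_mem_language (T := haltsAt) hp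
  simp only [hsig] at hK
  refine ⟨levelShift N p haltsAt, hX, isTransitive_levelShift, subset_levelShift hp hpY hY, hXr,
    isQuasiminimal_levelShift hp hpY hY hN, subshift_levelShift_iff hp hpY hY hN,
    isSigma1Complete_of_reducible (haltingAlongClopen_re hX hXr)
      ⟨fun n => gapInstance N (N + 4) (N + 3) (f n),
        (primrec_gapInstance N (N + 4) (N + 3)).to_comp.comp hf, fun n => ?_⟩,
    isSigma1Complete_of_reducible (modelChecking_re hXr)
      ⟨fun n => gapAutomaton N (N + 4) (f n ++ [N + 3]),
        (primrec_gapAutomaton N (N + 4)).to_comp.comp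
          (Computable.list_append.comp hf (Computable.const _)), fun n => ?_⟩⟩
  · rw [haltingAlongClopen_gapInstance hX (by omega), hK]
  · rw [modelChecking_gapAutomaton, hK]

theorem isMinimalSubshift_singleton_zero : IsMinimalSubshift {0} := by
  refine ⟨⟨isCompact_singleton, ?_⟩, Set.singleton_nonempty _,
    fun Z _ h => Set.subset_singleton_iff_eq.1 h⟩
  rw [Set.image_singleton]
  rfl

theorem isRecursive_singleton_zero : IsRecursive {0} := by
  have h : PrimrecPred fun a : ℕ => a = 0 := PrimrecRel.comp Primrec.eq Primrec.id (Primrec.const 0)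
  refine h.forall_mem_list.computablePred.of_eq fun w => ?_
  rw [mem_language]
  simp only [Set.mem_singleton_iff, exists_eq_left]
  have : ∀ i : ℤ, word 0 i w.length = List.replicate w.length 0 := fun i => by
    simp [word, List.map_const']
  simp only [this, exists_const]
  rw [eq_comm, List.eq_replicate_iff]
  simp

end ZShift

theorem mainTheorem1 :
    (∀ Y : Set (ℤ → ℕ), ZShift.IsMinimalSubshift Y → Y.Infinite → ZShift.IsRecursive Y →
      ∃ X : Set (ℤ → ℕ), ZShift.IsSubshift X ∧ ZShift.IsTransitive X ∧ ¬ X.Countable ∧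
        ZShift.IsRecursive X ∧ ZShift.IsQuasiminimal X ∧
        (∀ Z : Set (ℤ → ℕ),
          (ZShift.IsSubshift Z ∧ Z.Nonempty ∧ Z ⊂ X) ↔ Z = Y) ∧
        ZShift.IsSigma1Complete (ZShift.HaltingAlongClopen X)) ∧
    (∃ X : Set (ℤ → ℕ), ZShift.IsSubshift X ∧ ZShift.IsRecursive X ∧
      ZShift.IsQuasiminimal X ∧ ZShift.IsUniversal X) := by
  constructor
  · intro Y hY hinf hr
    obtain ⟨X, h1, h2, h3, h4, h5, h6, h7, -⟩ := hY.exists_universal hr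
    exact ⟨X, h1, h2, fun h => hY.not_countable hinf (h.mono h3), h4, h5, h6, h7⟩
  · obtain ⟨X, h1, -, -, h4, h5, -, -, h8⟩ :=
      ZShift.isMinimalSubshift_singleton_zero.exists_universal ZShift.isRecursive_singleton_zero
    exact ⟨X, h1, h4, h5, h8⟩
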